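/- Use the convention $\hat g(\omega)=\int_{\mathbb R} g(t)e^{-i\omega t}\,dt$. Let $N\ge 1$ and $L\ge 0$ be integers, let $\varphi=(\varphi_1,\dots,\varphi_N)\in L_2(\mathbb R)^N$ (basis functions) be such that $\{\varphi_i(\cdot-Nk)\}_{1\le i\le N,\,k\in\mathbb Z}$ is a Riesz basis of its closed span, that is, for some $0<A\le B<\infty$ and all $c\in\ell_2(\mathbb Z)^N$, $$A\sum_{i,k}|c_i[k]|^2\le\Big\|\sum_{i,k}c_i[k]\varphi_i(\cdot-Nk)\Big\|_{L_2}^2\le B\sum_{i,k}|c_i[k]|^2 ,$$ and let $\tilde\varphi=(\tilde\varphi_1,\dots,\tilde\varphi_N)$ (sampling functions) be rapidly decaying tempered distributions on $\mathbb R$ (the convolution with every Schwartz function decays faster than any polynomial; their Fourier transforms are then smooth functions of tempered growth). Let $$G(\omega)=\frac1N\sum_{k\in\mathbb Z}\hat\varphi\big(\omega+\tfrac{2\pi k}{N}\big)\,\hat\varphi\big(\omega+\tfrac{2\pi k}{N}\big)^{*},\qquad \hat\varphi_d(\omega)=G(\omega)^{-1}\hat\varphi(\omega)$$ be the Gram matrix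 and the Fourier transform of the dual functions $\varphi_d$. Assume that $(\varphi,\tilde\varphi)$ is quasi-biorthonormal of order $L$: for every integer $0\le\ell\le L-1$ there are sequences $c_{i,\ell}$ with $t^\ell=\sum_{i=1}^N\sum_{k\in\mathbb Z}c_{i,\ell}[k]\varphi_i(t-Nk)$ for almost every $t$ (absolutely convergent), and $\int t^\ell\tilde\varphi(t)\,dt=\int t^\ell\varphi_d(t)\,dt$, the second integral being absolutely convergent and the first one being understood as $i^\ell\hat{\tilde\varphi}^{(\ell)}(0)$. Let $$\mathcal E(\omega)=1-\frac1N\hat\varphi(\omega)^*G(\omega)^{-1}\hat\varphi(\omega)+\frac1N(\hat{\tilde\varphi}-\hat\varphi_d)(\omega)^{*}\,G(\omega)\,(\hat{\tilde\varphi}-\hat\varphi_d)(\omega),$$ and assume that $|\mathcal E(\omega)|\le C^2\max(1,|\omega|^{2p})$ for some $C>0$, some integer $0\le p\le L$ and almost every $\omega\in\mathbb R$. Let $f\in W_2^{L+1}(\mathbb R)$, and for $T>0$ let $$\mathcal Q_Tf=\sum_{i=1}^N\sum_{k\in\mathbb Z}\Big\langle f,\tfrac1T\tilde\varphi_i\big(\tfrac{\cdot}{T}-Nk\big)\Big\rangle\,\varphi_i\big(\tfrac{\cdot}{T}-Nk\big),\qquad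 \langle f,u\rangle=\frac1{2\pi}\int_{\mathbb R}\hat f(\omega)\overline{\hat u(\omega)}\,d\omega .$$ Then for every $T>0$ the integrals defining the coefficients converge absolutely, the series $\mathcal Q_Tf$ converges unconditionally in $L_2(\mathbb R)$, the function $|\hat f|^2\mathcal E(T\,\cdot)$ is integrable, and, as $T\to0^+$, $$\|f-\mathcal Q_Tf\|_{L_2}=\Big(\frac1{2\pi}\int_{\mathbb R}|\hat f(\omega)|^2\,\mathcal E(T\omega)\,d\omega\Big)^{1/2}+O(T^{L+1}).$$ -/

import Mathlib

open MeasureTheory Filter Topology Asymptotics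
open scoped SchwartzMap FourierTransform ENNReal Matrix ComplexConjugate

noncomputable section

namespace GenSampling

/-- The operator `g ↦ (s ↦ g (a * (s - b)))` on Schwartz functions (for `a ≠ 0`; by convention it is
`0` for `a = 0`). -/
def affineComp (a b : ℝ) : 𝓢(ℝ, ℂ) →L[ℂ] 𝓢(ℝ, ℂ) :=
  if h : a ≠ 0 then
    (SchwartzMap.compSubConstCLM ℂ b).comp
      (SchwartzMap.compCLMOfContinuousLinearEquiv ℂ
        (ContinuousLinearEquiv.unitsEquivAut ℝ (Units.mk0 a h)))
  else 0

theorem affineComp_apply {a : ℝ} (ha : a ≠ 0) (b : ℝ) (g : 𝓢(ℝ, ℂ)) (s : ℝ) :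
    affineComp a b g s = g (a * (s - b)) := by
  simp [affineComp, ha, mul_comm]

/-- The class in `L²(ℝ)` of a square-integrable function. -/
def toL2 (g : ℝ → ℂ) : Lp ℂ 2 (volume : Measure ℝ) :=
  open Classical in if h : MemLp g 2 volume then h.toLp g else 0

/-! ### Fourier transforms, in the convention `ĝ(ω) = ∫ g(t) exp(-iωt) dt` -/

/-- The Fourier transform `ĝ(ω) = ∫ g(t) exp(-iωt) dt` of an `L²` function
(Mathlib's `𝓕 g` is taken in the variable `ω / 2π`); it is defined almost everywhere. -/
def fourierL2 (g : Lp ℂ 2 (volume : Measure ℝ)) (ω : ℝ) : ℂ :=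
  (𝓕 g : Lp ℂ 2 (volume : Measure ℝ)) (ω / (2 * Real.pi))

/-- A tempered generalized function is rapidly decaying if its convolution
`x ↦ ⟨u, g(x - ·)⟩` with every Schwartz function `g` decays faster than any polynomial. -/
def IsRapidlyDecaying (u : 𝓢'(ℝ, ℂ)) : Prop :=
  ∀ (g : 𝓢(ℝ, ℂ)) (n : ℕ), ∃ C : ℝ, ∀ x : ℝ, |x| ^ n * ‖u (affineComp (-1) x g)‖ ≤ C

/-- The Fourier transform `û(ω)` of a rapidly decaying generalized function `u`, as a function:
the unique smooth function of tempered growth that represents the distributional Fourier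
transform of `u`. -/
def fourierDist (u : 𝓢'(ℝ, ℂ)) (ω : ℝ) : ℂ :=
  open Classical in
  if h : ∃ H : ℝ → ℂ, ∃ hH : H.HasTemperateGrowth,
      𝓕 u = Function.HasTemperateGrowth.toTemperedDistribution (μ := volume) hH then
    h.choose (ω / (2 * Real.pi))
  else 0

/-- The moment `∫ t^ℓ u(t) dt = i^ℓ û^(ℓ)(0)` of a rapidly decaying generalized function. -/
def moment (u : 𝓢'(ℝ, ℂ)) (ℓ : ℕ) : ℂ :=
  Complex.I ^ ℓ * iteratedDeriv ℓ (fourierDist u) 0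

/-- The integrand `f̂(ω) conj (û(ω))` of the duality pairing of a function and a generalized
function. -/
def pairingIntegrand (f : Lp ℂ 2 (volume : Measure ℝ)) (u : 𝓢'(ℝ, ℂ)) (ω : ℝ) : ℂ :=
  fourierL2 f ω * conj (fourierDist u ω)

/-- The (sesquilinear) duality pairing `⟨f, u⟩ = (2π)⁻¹ ∫ f̂(ω) conj (û(ω)) dω`, which extends
`∫ f(t) conj (u(t)) dt`. -/
def pairing (f : Lp ℂ 2 (volume : Measure ℝ)) (u : 𝓢'(ℝ, ℂ)) : ℂ :=
  1 / (2 * Real.pi) * ∫ ω, pairingIntegrand f u ω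

/-! ### Approximation schemes -/

/-- The rescaled and shifted generalized function `T⁻¹ u(·/T - a)`, for `T ≠ 0`:
`∫ T⁻¹ u(t/T - a) g(t) dt = ∫ u(s) g(T(s + a)) ds`. -/
def rescaleDist (T a : ℝ) (u : 𝓢'(ℝ, ℂ)) : 𝓢'(ℝ, ℂ) :=
  PointwiseConvergenceCLM.precomp ℂ (affineComp T (-a)) u

theorem rescaleDist_apply (T a : ℝ) (u : 𝓢'(ℝ, ℂ)) (g : 𝓢(ℝ, ℂ)) :
    rescaleDist T a u g = u (affineComp T (-a) g) := rfl

variable {N : ℕ}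

/-- The functions `φ_i(· / T - N k)` as elements of `L²`. -/
def atom (φ : Fin N → ℝ → ℂ) (T : ℝ) (q : Fin N × ℤ) : Lp ℂ 2 (volume : Measure ℝ) :=
  toL2 (fun t => φ q.1 (t / T - N * q.2))

/-- The generalized functions `T⁻¹ φ̃_i(· / T - N k)`. -/
def sampler (ψ : Fin N → 𝓢'(ℝ, ℂ)) (T : ℝ) (q : Fin N × ℤ) : 𝓢'(ℝ, ℂ) :=
  rescaleDist T (N * q.2) (ψ q.1)

/-- The terms `⟨f, T⁻¹ φ̃_i(· / T - N k)⟩ φ_i(· / T - N k)` of the approximation of `f`. -/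
def approxTerm (φ : Fin N → ℝ → ℂ) (ψ : Fin N → 𝓢'(ℝ, ℂ)) (T : ℝ)
    (f : Lp ℂ 2 (volume : Measure ℝ)) (q : Fin N × ℤ) : Lp ℂ 2 (volume : Measure ℝ) :=
  pairing f (sampler ψ T q) • atom φ T q

/-- The approximation `Q_T f = ∑ᵢ ∑ₖ ⟨f, T⁻¹ φ̃_i(· / T - N k)⟩ φ_i(· / T - N k)`. -/
def approx (φ : Fin N → ℝ → ℂ) (ψ : Fin N → 𝓢'(ℝ, ℂ)) (T : ℝ)
    (f : Lp ℂ 2 (volume : Measure ℝ)) : Lp ℂ 2 (volume : Measure ℝ) :=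
  ∑' q : Fin N × ℤ, approxTerm φ ψ T f q

/-- The family `(φ_i(· - N k))` is a Riesz basis (of its closed span): for all square-summable
coefficients the series converges in `L²` and its norm is comparable to that of the coefficients. -/
def IsRiesz (φ : Fin N → ℝ → ℂ) : Prop :=
  ∃ A B : ℝ, 0 < A ∧ A ≤ B ∧ ∀ c : Fin N × ℤ → ℂ, Summable (fun q => ‖c q‖ ^ 2) →
    Summable (fun q => c q • atom φ 1 q) ∧
    A * ∑' q, ‖c q‖ ^ 2 ≤ ‖∑' q, c q • atom φ 1 q‖ ^ 2 ∧
    ‖∑' q, c q • atom φ 1 q‖ ^ 2 ≤ B * ∑' q, ‖c q‖ ^ 2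

/-- The family `φ` is of order `L`: it reproduces the monomials `t^ℓ`, `ℓ < L`. -/
def IsOfOrder (φ : Fin N → ℝ → ℂ) (L : ℕ) : Prop :=
  ∀ ℓ < L, ∃ c : Fin N × ℤ → ℂ, ∀ᵐ t : ℝ,
    HasSum (fun q : Fin N × ℤ => c q * φ q.1 (t - N * q.2)) ((t : ℂ) ^ ℓ)

/-- The vector `φ̂(ω)`. -/
def basisHat (φ : Fin N → ℝ → ℂ) (ω : ℝ) : Fin N → ℂ :=
  fun i => fourierL2 (toL2 (φ i)) ω

/-- The vector of the Fourier transforms of the sampling functions at `ω`. -/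
def samplingHat (ψ : Fin N → 𝓢'(ℝ, ℂ)) (ω : ℝ) : Fin N → ℂ :=
  fun i => fourierDist (ψ i) ω

/-- The Gram matrix `G(ω) = N⁻¹ ∑ₖ φ̂(ω + 2πk/N) φ̂(ω + 2πk/N)*` of the family `(φ_i(· - N k))`. -/
def gram (φ : Fin N → ℝ → ℂ) (ω : ℝ) : Matrix (Fin N) (Fin N) ℂ :=
  Matrix.of fun i j => 1 / (N : ℂ) * ∑' k : ℤ,
    basisHat φ (ω + 2 * Real.pi * k / N) i * conj (basisHat φ (ω + 2 * Real.pi * k / N) j)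

/-- The Fourier transform `G(ω)⁻¹ φ̂(ω)` of the vector of dual functions. -/
def dualHat (φ : Fin N → ℝ → ℂ) (ω : ℝ) : Fin N → ℂ :=
  (gram φ ω)⁻¹ *ᵥ basisHat φ ω

/-- The dual functions `φ_d`, the inverse Fourier transform of `G⁻¹ φ̂`. -/
def dualFun (φ : Fin N → ℝ → ℂ) (i : Fin N) : Lp ℂ 2 (volume : Measure ℝ) :=
  𝓕⁻ (toL2 (fun ξ => dualHat φ (2 * Real.pi * ξ) i))

/-- Quasi-biorthonormality of order `L`: the basis functions are of order `L`, and the sampling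
functions have the same moments of order `< L` as the dual functions. -/
def IsQuasiBiorthonormal (φ : Fin N → ℝ → ℂ) (ψ : Fin N → 𝓢'(ℝ, ℂ)) (L : ℕ) : Prop :=
  IsOfOrder φ L ∧ ∀ ℓ < L, ∀ i : Fin N,
    Integrable (fun t : ℝ => (t : ℂ) ^ ℓ * dualFun φ i t) ∧
    moment (ψ i) ℓ = ∫ t : ℝ, (t : ℂ) ^ ℓ * dualFun φ i t

/-- The minimum-error kernel `1 - N⁻¹ φ̂* G⁻¹ φ̂` (the quadratic form is real since `G` is
Hermitian). -/
def kernelMin (φ : Fin N → ℝ → ℂ) (ω : ℝ) : ℝ :=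
  1 - 1 / (N : ℝ) * (star (basisHat φ ω) ⬝ᵥ ((gram φ ω)⁻¹ *ᵥ basisHat φ ω)).re

/-- The residual kernel `N⁻¹ d* G d`, where `d` is the difference of the Fourier transforms of the
sampling and the dual functions. -/
def kernelRes (φ : Fin N → ℝ → ℂ) (ψ : Fin N → 𝓢'(ℝ, ℂ)) (ω : ℝ) : ℝ :=
  1 / (N : ℝ) * (star (samplingHat ψ ω - dualHat φ ω) ⬝ᵥ
    (gram φ ω *ᵥ (samplingHat ψ ω - dualHat φ ω))).re

/-- The error kernel of the approximation scheme. -/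
def kernel (φ : Fin N → ℝ → ℂ) (ψ : Fin N → 𝓢'(ℝ, ℂ)) (ω : ℝ) : ℝ :=
  kernelMin φ ω + kernelRes φ ψ ω

end GenSampling

end

open GenSampling

/-! In the variable `ξ = ω / 2π` and with `h = 1 / N`, a shift by `N k` becomes multiplication by a
character of period `h`. Cut the frequency axis into bands of width `h` centred at `n h`. If `F`,
the transform of `f`, lives in one band, there is no aliasing: its samples are the Fourier
coefficients of the `h`-periodic extensions of `h F conj Ψ_i`, so on the translate by `m h` the
transform of the approximation is `h F(ξ) ∑ᵢ conj Ψ_i(ξ) Φ_i(ξ + m h)`. Summing the squared errors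
over `m` and expanding the quadratic forms in the Gram matrix gives exactly `∫ |F|² K`, with `K` the
error kernel (`hasSum_kernel`, `norm_sq_band_error`).

A general `F` is the sum of its band parts, with errors `d_n`. The true error is `‖∑ d_n‖`, the
predicted one is `(∑ ‖d_n‖²)^(1/2)`, and both differ from `‖d_0‖` by at most `∑_{n ≠ 0} ‖d_n‖`. On a
band `n ≠ 0` one has `|ξ| ≥ |n| h / 2`, so the growth `ξ^(2p)` of `K`, with `p ≤ L`, is at most a
constant times `n⁻² ξ^(2L+2)`; Cauchy–Schwarz bounds the tail by a multiple of the norm of `ξ^(L+1)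
F` (`summable_bandNorm`, `error_estimate`).

Scale `T` reduces to scale one by replacing `F` with `T⁻¹ F(·/T)`; the weight `ξ^(L+1)` then
produces `T^(L+1)`. The lower Riesz bound acts fibrewise (`ae_frame`): it makes the Gram matrix
invertible and turns the growth of the kernel into growth of the sampling functions
(`sampling_bound`), whence all the convergence statements. -/

noncomputable section

namespace GenSampling

/-! ### Affine changes of variables and the Fourier transform -/

/-- The unimodular function `exp (-2πi x)`. -/
def phase (x : ℝ) : ℂ := Complex.exp (((-2 * Real.pi * x : ℝ) : ℂ) * Complex.I)

theorem norm_phase (x : ℝ) : ‖phase x‖ = 1 := Complex.norm_exp_ofReal_mul_I _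

theorem phase_add (x y : ℝ) : phase (x + y) = phase x * phase y := by
  rw [phase, phase, phase, ← Complex.exp_add]; congr 1; push_cast; ring

theorem continuous_phase : Continuous phase := by unfold phase; fun_prop

theorem hasTemperateGrowth_phase : phase.HasTemperateGrowth := by
  refine Function.HasTemperateGrowth.comp (g := fun z : ℝ => Complex.exp ((z : ℂ) * Complex.I))
    (f := fun x : ℝ => -2 * Real.pi * x) ?_ (by fun_prop)
  have hsm : ContDiff ℝ (⊤ : ℕ∞) (fun z : ℝ => Complex.exp ((z : ℂ) * Complex.I)) := by
    have : ContDiff ℝ (⊤ : ℕ∞) (fun z : ℝ => (z : ℂ)) := Complex.ofRealCLM.contDiff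
    fun_prop
  -- Every derivative of `exp(iz)` has modulus one, so exponent `0` and constant `1` suffice.
  refine ⟨hsm, fun n => ⟨0, 1, fun x => ?_⟩⟩
  rw [norm_iteratedFDeriv_eq_norm_iteratedDeriv]
  have key : ∀ n : ℕ, iteratedDeriv n (fun z : ℝ => Complex.exp ((z : ℂ) * Complex.I)) =
      fun z : ℝ => Complex.I ^ n * Complex.exp ((z : ℂ) * Complex.I) := by
    intro n
    induction n with
    | zero => simp
    | succ n ih =>
      rw [iteratedDeriv_succ, ih]
      funext z
      have h1 : HasDerivAt (fun z : ℝ => (z : ℂ) * Complex.I) (1 * Complex.I) z :=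
        (Complex.ofRealCLM.hasDerivAt (x := z)).mul_const _
      have h2 := (h1.cexp.const_mul (Complex.I ^ n)).deriv
      rw [h2]; ring
  rw [key]
  simp [Complex.norm_exp_ofReal_mul_I]

theorem hasTemperateGrowth_phase_mul (a : ℝ) :
    (fun y : ℝ => phase (a * y)).HasTemperateGrowth :=
  hasTemperateGrowth_phase.comp (f := fun y : ℝ => a * y) (by fun_prop)

/-- The operator `g ↦ (y ↦ T⁻¹ g(y / T) exp(-2πi a y))` on Schwartz functions, for `T ≠ 0`. -/
def modDil (T a : ℝ) (g : 𝓢(ℝ, ℂ)) : 𝓢(ℝ, ℂ) :=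
  ((T : ℂ)⁻¹) • SchwartzMap.smulLeftCLM ℂ (fun y : ℝ => phase (a * y)) (affineComp T⁻¹ 0 g)

theorem modDil_apply {T : ℝ} (hT : 0 < T) (a : ℝ) (g : 𝓢(ℝ, ℂ)) (y : ℝ) :
    modDil T a g y = (T : ℂ)⁻¹ * (phase (a * y) * g (T⁻¹ * y)) := by
  rw [modDil, _root_.smul_apply,
    SchwartzMap.smulLeftCLM_apply_apply (hasTemperateGrowth_phase_mul a),
    affineComp_apply (inv_ne_zero hT.ne'), sub_zero, smul_eq_mul, smul_eq_mul]

theorem schwartz_fourier_apply (g : 𝓢(ℝ, ℂ)) (w : ℝ) : 𝓕 g w = ∫ v : ℝ, phase (v * w) * g v := by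
  rw [SchwartzMap.fourier_coe, Real.fourier_real_eq_integral_exp_smul]
  refine integral_congr_ae (Eventually.of_forall fun v => ?_)
  simp only [phase, smul_eq_mul, mul_assoc]

/-- The substitution `y = T v` in the Fourier integral. By transposition it describes the Fourier
transform of a rescaled generalized function. -/
theorem affineComp_fourier {T : ℝ} (hT : 0 < T) (a : ℝ) (g : 𝓢(ℝ, ℂ)) :
    affineComp T (-a) (𝓕 g) = 𝓕 (modDil T a g) := by
  ext s
  rw [affineComp_apply hT.ne', schwartz_fourier_apply, schwartz_fourier_apply]
  have h := Measure.integral_comp_mul_left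
    (fun y : ℝ => phase (y * (s - -a)) * g (T⁻¹ * y)) T
  simp only [inv_mul_cancel_left₀ hT.ne'] at h
  have e : ∀ v : ℝ, phase (v * (T * (s - -a))) * g v = phase (T * v * (s - -a)) * g v := by
    intro v; congr 2; ring
  simp_rw [e, h, modDil_apply hT]
  rw [abs_of_pos (inv_pos.2 hT), ← integral_smul]
  refine integral_congr_ae (Eventually.of_forall fun v => ?_)
  simp only [sub_neg_eq_add, mul_add, phase_add, Complex.real_smul, Complex.ofReal_inv]
  rw [mul_comm v a]; ring

theorem fourier_rescaleDist {T : ℝ} (hT : 0 < T) (a : ℝ) (u : 𝓢'(ℝ, ℂ)) (g : 𝓢(ℝ, ℂ)) :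
    𝓕 (rescaleDist T a u) g = 𝓕 u (modDil T a g) := by
  rw [TemperedDistribution.fourier_apply, TemperedDistribution.fourier_apply, rescaleDist_apply,
    affineComp_fourier hT]

theorem integral_modDil {T : ℝ} (hT : 0 < T) (a : ℝ) (g : 𝓢(ℝ, ℂ)) (H : ℝ → ℂ) :
    ∫ y, modDil T a g y * H y = ∫ x, g x * (phase (T * a * x) * H (T * x)) := by
  have h := Measure.integral_comp_mul_left
    (fun y : ℝ => phase (a * y) * g (T⁻¹ * y) * H y) T
  simp only [inv_mul_cancel_left₀ hT.ne'] at h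
  have e : ∀ x : ℝ, g x * (phase (T * a * x) * H (T * x))
      = phase (a * (T * x)) * g x * H (T * x) := by
    intro x; rw [show a * (T * x) = T * a * x by ring]; ring
  simp_rw [e, h, modDil_apply hT]
  rw [abs_of_pos (inv_pos.2 hT), ← integral_smul]
  refine integral_congr_ae (Eventually.of_forall fun v => ?_)
  simp only [Complex.real_smul, Complex.ofReal_inv]; ring

/-- `u` has the smooth function of tempered growth `H` as its Fourier transform. -/
def HasFourierSymbol (u : 𝓢'(ℝ, ℂ)) (H : ℝ → ℂ) : Prop :=
  ∃ hH : H.HasTemperateGrowth,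
    𝓕 u = Function.HasTemperateGrowth.toTemperedDistribution (μ := volume) hH

/-- Continuous functions that agree as distributions agree almost everywhere, hence everywhere. This
makes the choice in `fourierDist` harmless, even pointwise. -/
theorem HasFourierSymbol.unique {u : 𝓢'(ℝ, ℂ)} {H K : ℝ → ℂ} (hH : HasFourierSymbol u H)
    (hK : HasFourierSymbol u K) : H = K := by
  obtain ⟨hH, eH⟩ := hH
  obtain ⟨hK, eK⟩ := hK
  have hcH : Continuous H := hH.1.continuous
  have hcK : Continuous K := hK.1.continuous
  refine (Continuous.ae_eq_iff_eq volume hcH hcK).1 ?_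
  refine ae_eq_of_integral_contDiff_smul_eq hcH.locallyIntegrable hcK.locallyIntegrable ?_
  intro g g_smooth g_cpt
  have hg₁ : HasCompactSupport (Complex.ofRealCLM ∘ g) := g_cpt.comp_left rfl
  have hg₂ : ContDiff ℝ (⊤ : ℕ∞) (Complex.ofRealCLM ∘ g) := by fun_prop
  have := congrArg (fun v : 𝓢'(ℝ, ℂ) => v (hg₁.toSchwartzMap hg₂)) (eH.symm.trans eK)
  simpa using this

theorem HasFourierSymbol.rescale {u : 𝓢'(ℝ, ℂ)} {H : ℝ → ℂ} (hu : HasFourierSymbol u H)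
    {T : ℝ} (hT : 0 < T) (a : ℝ) :
    HasFourierSymbol (rescaleDist T a u) (fun x => phase (T * a * x) * H (T * x)) := by
  obtain ⟨hH, eH⟩ := hu
  have h1 : (fun x : ℝ => H (T * x)).HasTemperateGrowth :=
    hH.comp (f := fun y : ℝ => T * y) (by fun_prop)
  refine ⟨(hasTemperateGrowth_phase_mul (T * a)).mul h1, ?_⟩
  ext g
  rw [fourier_rescaleDist hT, eH]
  simpa using integral_modDil hT a g H

theorem rescaleDist_inv {T : ℝ} (hT : 0 < T) (a : ℝ) (u : 𝓢'(ℝ, ℂ)) :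
    rescaleDist T⁻¹ (-(T * a)) (rescaleDist T a u) = u := by
  ext g
  rw [rescaleDist_apply, rescaleDist_apply]
  congr 1
  ext s
  rw [affineComp_apply hT.ne', affineComp_apply (inv_ne_zero hT.ne')]
  congr 1
  field_simp
  ring

theorem fourierDist_eq_of_hasFourierSymbol {u : 𝓢'(ℝ, ℂ)} {H : ℝ → ℂ} (hu : HasFourierSymbol u H)
    (ω : ℝ) : fourierDist u ω = H (ω / (2 * Real.pi)) := by
  have h : ∃ H : ℝ → ℂ, ∃ hH : H.HasTemperateGrowth,
      𝓕 u = Function.HasTemperateGrowth.toTemperedDistribution (μ := volume) hH := ⟨H, hu⟩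
  rw [fourierDist, dif_pos h, HasFourierSymbol.unique h.choose_spec hu]

theorem fourierDist_rescaleDist {T : ℝ} (hT : 0 < T) (a : ℝ) (u : 𝓢'(ℝ, ℂ)) (ξ : ℝ) :
    fourierDist (rescaleDist T a u) (2 * Real.pi * ξ) =
      phase (T * a * ξ) * fourierDist u (2 * Real.pi * (T * ξ)) := by
  have hpi : (2 * Real.pi) ≠ 0 := by positivity
  by_cases h : ∃ H, HasFourierSymbol u H
  · obtain ⟨H, hH⟩ := h
    rw [fourierDist_eq_of_hasFourierSymbol hH,
      fourierDist_eq_of_hasFourierSymbol (hH.rescale hT a)]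
    simp only [mul_div_cancel_left₀ _ hpi]
  -- Without a symbol both sides take the default value `0`: rescaling is invertible, so a symbol of
  -- the rescaled object would give one of `u`.
  · have h' : ¬ ∃ H, HasFourierSymbol (rescaleDist T a u) H := by
      rintro ⟨H, hH⟩
      have := hH.rescale (inv_pos.2 hT) (-(T * a))
      rw [rescaleDist_inv hT] at this
      exact h ⟨_, this⟩
    have e1 : ∀ ω, fourierDist u ω = 0 := fun ω => dif_neg h
    have e2 : ∀ ω, fourierDist (rescaleDist T a u) ω = 0 := fun ω => dif_neg h'
    rw [e1, e2, mul_zero]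

theorem continuous_fourierDist (u : 𝓢'(ℝ, ℂ)) : Continuous (fourierDist u) := by
  by_cases h : ∃ H, HasFourierSymbol u H
  · obtain ⟨H, hH⟩ := h
    have : fourierDist u = fun ω => H (ω / (2 * Real.pi)) :=
      funext (fourierDist_eq_of_hasFourierSymbol hH)
    rw [this]
    exact hH.1.1.continuous.comp (by fun_prop)
  · have : fourierDist u = fun _ => 0 := funext fun ω => dif_neg h
    rw [this]; exact continuous_const

/-! ### Dilations and translations of square-integrable functions -/

theorem toL2_coeFn {g : ℝ → ℂ} (hg : MemLp g 2 volume) : toL2 g =ᵐ[volume] g := by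
  rw [toL2, dif_pos hg]; exact hg.coeFn_toLp

theorem toL2_congr {g h : ℝ → ℂ} (hgh : g =ᵐ[volume] h) : toL2 g = toL2 h := by
  by_cases hg : MemLp g 2 volume
  · have hh := hg.ae_eq hgh
    rw [toL2, dif_pos hg, toL2, dif_pos hh]
    exact MemLp.toLp_congr _ _ hgh
  · have hh : ¬ MemLp h 2 volume := fun hh => hg (hh.ae_eq hgh.symm)
    rw [toL2, dif_neg hg, toL2, dif_neg hh]

theorem quasiMeasurePreserving_div_sub {T : ℝ} (hT : 0 < T) (a : ℝ) :
    Measure.QuasiMeasurePreserving (fun t : ℝ => t / T - a) volume volume := by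
  have h1 : Measure.QuasiMeasurePreserving (fun t : ℝ => T⁻¹ * t) volume volume := by
    refine ⟨by fun_prop, ?_⟩
    rw [Real.map_volume_mul_left (inv_ne_zero hT.ne')]
    exact Measure.smul_absolutelyContinuous
  have h2 := (measurePreserving_sub_right (volume : Measure ℝ) a).quasiMeasurePreserving.comp h1
  convert h2 using 2
  simp [div_eq_inv_mul]

theorem map_mul_left_volume {T : ℝ} (hT : 0 < T) :
    Measure.map (fun x : ℝ => T * x) volume = ENNReal.ofReal T⁻¹ • volume := by
  rw [Real.map_volume_mul_left hT.ne', abs_of_pos (inv_pos.2 hT)]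

theorem quasiMeasurePreserving_mul_left {T : ℝ} (hT : 0 < T) :
    Measure.QuasiMeasurePreserving (fun t : ℝ => T * t) volume volume := by
  refine ⟨by fun_prop, ?_⟩
  rw [map_mul_left_volume hT]
  exact Measure.smul_absolutelyContinuous

theorem MemLp.comp_mul_left {g : ℝ → ℂ} (hg : MemLp g 2 volume) {T : ℝ} (hT : 0 < T) :
    MemLp (fun t => g (T * t)) 2 volume := by
  have : MemLp g 2 (Measure.map (fun x : ℝ => T * x) volume) := by
    rw [map_mul_left_volume hT]
    exact hg.smul_measure ENNReal.ofReal_ne_top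
  exact (memLp_map_measure_iff this.1 (by fun_prop)).1 this

theorem MemLp.comp_div_sub {g : ℝ → ℂ} (hg : MemLp g 2 volume) {T : ℝ} (hT : 0 < T) (a : ℝ) :
    MemLp (fun t => g (t / T - a)) 2 volume := by
  have h1 : MemLp (fun t => g (t - a)) 2 volume :=
    hg.comp_measurePreserving (measurePreserving_sub_right (volume : Measure ℝ) a)
  have h2 := MemLp.comp_mul_left h1 (inv_pos.2 hT)
  simpa [div_eq_inv_mul] using h2

/-- Proved by duality: `L²` embeds injectively in tempered distributions, where rescaling and the
Fourier transform are both transposes of operators on Schwartz functions. -/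
theorem fourier_toL2_div_sub (f : Lp ℂ 2 (volume : Measure ℝ)) {T : ℝ} (hT : 0 < T) (a : ℝ) :
    (𝓕 (toL2 (fun t => f (t / T - a))) : Lp ℂ 2 (volume : Measure ℝ)) =ᵐ[volume]
      fun ξ => T * (phase (T * a * ξ) * (𝓕 f : Lp ℂ 2 (volume : Measure ℝ)) (T * ξ)) := by
  have hm : MemLp (fun t => f (t / T - a)) 2 volume := MemLp.comp_div_sub (Lp.memLp f) hT a
  set F : Lp ℂ 2 (volume : Measure ℝ) := 𝓕 f with hF
  have hFm : MemLp (fun ξ => (T : ℂ) * (phase (T * a * ξ) * F (T * ξ))) 2 volume := by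
    have h0 := MemLp.comp_mul_left (Lp.memLp F) hT
    have h1 : MemLp (fun ξ => phase (T * a * ξ) * F (T * ξ)) 2 volume := by
      refine h0.of_le_mul (c := 1) ?_ (Eventually.of_forall fun ξ => ?_)
      · exact (continuous_phase.comp (by fun_prop)).aestronglyMeasurable.mul h0.1
      · simp [norm_phase]
    exact h1.const_mul _
  suffices h : (𝓕 (toL2 (fun t => f (t / T - a))) : Lp ℂ 2 (volume : Measure ℝ)) = hFm.toLp _ by
    rw [h]; exact hFm.coeFn_toLp
  have hinj : Function.Injective (Lp.toTemperedDistributionCLM ℂ (volume : Measure ℝ) 2) :=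
    LinearMap.ker_eq_bot.1 Lp.ker_toTemperedDistributionCLM_eq_bot
  apply hinj
  rw [Lp.toTemperedDistributionCLM_apply, Lp.toTemperedDistributionCLM_apply,
    ← Lp.fourier_toTemperedDistribution_eq]
  -- The factor `T` compensates the `T⁻¹` built into `rescaleDist`.
  have hdist : (toL2 (fun t => f (t / T - a)) : 𝓢'(ℝ, ℂ)) =
      (T : ℂ) • rescaleDist T a (f : 𝓢'(ℝ, ℂ)) := by
    ext g
    rw [_root_.smul_apply, rescaleDist_apply, Lp.toTemperedDistribution_apply,
      Lp.toTemperedDistribution_apply]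
    have h1 : ∫ x, g x • (toL2 fun t => f (t / T - a)) x = ∫ x, g x • f (x / T - a) :=
      integral_congr_ae ((toL2_coeFn hm).mono fun x hx => by simp only [hx])
    rw [h1]
    have h2 := Measure.integral_comp_inv_mul_left
      (fun s : ℝ => g (T * (s - a + a)) • f (s - a)) T
    have h3 := integral_sub_right_eq_self (μ := volume) (fun s : ℝ => g (T * (s + a)) • f s) a
    rw [h3] at h2
    simp_rw [affineComp_apply hT.ne', sub_neg_eq_add]
    rw [abs_of_pos hT] at h2
    rw [Complex.coe_smul, ← h2]
    refine integral_congr_ae (Eventually.of_forall fun x => ?_)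
    simp only [sub_add_cancel, mul_inv_cancel_left₀ hT.ne', div_eq_inv_mul]
  rw [hdist]
  ext g
  rw [FourierTransform.fourier_smul, _root_.smul_apply, fourier_rescaleDist hT,
    Lp.fourier_toTemperedDistribution_eq, Lp.toTemperedDistribution_apply,
    Lp.toTemperedDistribution_apply]
  simp only [smul_eq_mul]
  rw [integral_modDil hT, ← integral_const_mul]
  refine integral_congr_ae (hFm.coeFn_toLp.mono fun x hx => ?_)
  simp only [hx]; ring

/-! ### Periodization -/

/-- A countable index set has countably many finite subsets, so one null set serves all partial
sums; limits along subsequences of partial sums can then be read pointwise. -/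
theorem coeFn_sum_smul {α κ : Type*} [Countable κ] {m : MeasurableSpace α} {μ : Measure α}
    (c : κ → ℂ) (b : κ → Lp ℂ 2 μ) :
    ∀ᵐ x ∂μ, ∀ F : Finset κ, (∑ k ∈ F, c k • b k : Lp ℂ 2 μ) x = ∑ k ∈ F, c k * b k x := by
  have h1 : ∀ᵐ x ∂μ, ∀ k, (c k • b k : Lp ℂ 2 μ) x = c k * b k x :=
    ae_all_iff.2 fun k => Lp.coeFn_smul (c k) (b k)
  have h2 : ∀ᵐ x ∂μ, ∀ F : Finset κ,
      (∑ k ∈ F, c k • b k : Lp ℂ 2 μ) x = ∑ k ∈ F, (c k • b k : Lp ℂ 2 μ) x :=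
    ae_all_iff.2 fun F => Lp.coeFn_fun_finsetSum _ _
  filter_upwards [h1, h2] with x h3 h4 F
  rw [h4]
  exact Finset.sum_congr rfl fun k _ => h3 k

section Periodic

variable {h : ℝ}

theorem ae_of_forall_ae_Ioc (hh : 0 < h) {P : ℝ → Prop}
    (H : ∀ a : ℝ, ∀ᵐ ξ ∂(volume.restrict (Set.Ioc a (a + h))), P ξ) : ∀ᵐ ξ : ℝ, P ξ := by
  have h1 : ∀ᵐ ξ ∂(volume.restrict (⋃ n : ℤ, Set.Ioc (0 + n • h) (0 + (n + 1) • h))), P ξ := by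
    rw [ae_restrict_iUnion_iff]
    intro n
    have := H (0 + n • h)
    rwa [show 0 + n • h + h = 0 + (n + 1) • h by rw [add_smul, one_smul, add_assoc]] at this
  rwa [iUnion_Ioc_add_zsmul hh, Measure.restrict_univ] at h1

theorem ae_shift {P : ℝ → Prop} (H : ∀ᵐ ξ : ℝ, P ξ) (h : ℝ) : ∀ᵐ ξ : ℝ, ∀ n : ℤ, P (ξ + n * h) :=
  ae_all_iff.2 fun n =>
    (measurePreserving_add_right (volume : Measure ℝ) (n * h)).quasiMeasurePreserving.ae H

theorem lintegral_eq_lintegral_Ioc_tsum (hh : 0 < h) (a : ℝ) {u : ℝ → ℝ≥0∞}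
    (hu : AEMeasurable u volume) :
    ∫⁻ ξ, u ξ = ∫⁻ ξ in Set.Ioc a (a + h), ∑' n : ℤ, u (ξ + n * h) := by
  have hm : ∀ n : ℤ, AEMeasurable (fun ξ : ℝ => u (ξ + n * h)) volume := fun n =>
    hu.comp_quasiMeasurePreserving
      (measurePreserving_add_right (volume : Measure ℝ) (n * h)).quasiMeasurePreserving
  rw [lintegral_tsum fun n => (hm n).restrict, ← setLIntegral_univ, ← iUnion_Ioc_add_zsmul hh a,
    lintegral_iUnion (fun n => measurableSet_Ioc) (Set.pairwise_disjoint_Ioc_add_zsmul a h)]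
  refine tsum_congr fun n => ?_
  have := (measurePreserving_add_right (volume : Measure ℝ) (n * h)).setLIntegral_comp_preimage_emb
    (measurableEmbedding_addRight _) u (Set.Ioc (a + n • h) (a + (n + 1) • h))
  rw [← this]
  congr 2
  ext x
  simp only [Set.mem_preimage, Set.mem_Ioc, zsmul_eq_mul]
  push_cast
  constructor <;> rintro ⟨h1, h2⟩ <;> constructor <;> linarith

theorem fourier_coe_eq_phase (n : ℤ) (x : ℝ) :
    fourier n (x : AddCircle h) = phase (-(n * x / h)) := by
  rw [fourier_coe_apply, phase]; congr 1; push_cast; ring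

variable [Fact (0 < h)]

theorem ae_coe_addCircle {P : AddCircle h → Prop} (H : ∀ᵐ x ∂(AddCircle.haarAddCircle), P x) :
    ∀ᵐ ξ : ℝ, P (ξ : AddCircle h) := by
  refine ae_of_forall_ae_Ioc (h := h) Fact.out fun a => ?_
  have H' : ∀ᵐ x : AddCircle h, P x := by
    rw [AddCircle.volume_eq_smul_haarAddCircle]
    exact Measure.smul_absolutelyContinuous.ae_le H
  exact (AddCircle.measurePreserving_mk h a).quasiMeasurePreserving.ae H'

/-- If `b_k` is the modulation of `Φ` by `exp(-2πi k ξ / h)`, then `∑ₖ ĝ(-k) b_k = g Φ` for every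
square-integrable periodic function `g`. -/
theorem tsum_fourierCoeff_smul_ae {Φ : ℝ → ℂ} {b : ℤ → Lp ℂ 2 (volume : Measure ℝ)}
    (hb : ∀ k : ℤ, b k =ᵐ[volume] fun ξ => phase (k * ξ / h) * Φ ξ)
    (g : Lp ℂ 2 (@AddCircle.haarAddCircle h _))
    (hs : Summable fun k : ℤ => fourierCoeff g (-k) • b k) :
    (∑' k : ℤ, fourierCoeff g (-k) • b k : Lp ℂ 2 (volume : Measure ℝ)) =ᵐ[volume]
      fun ξ => g (ξ : AddCircle h) * Φ ξ := by
  obtain ⟨c, hc⟩ : ∃ c : ℤ → ℂ, ∀ k, fourierCoeff g (-k) = c k := ⟨_, fun _ => rfl⟩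
  simp only [hc] at hs ⊢
  -- The modulation `phase (k ξ / h)` is the character of index `-k`, hence the reindexing by
  -- negation.
  have h2 : Tendsto (fun F : Finset ℤ => ∑ k ∈ F, c k • (fourierLp 2 (-k) :
      Lp ℂ 2 (@AddCircle.haarAddCircle h _))) atTop (𝓝 g) := by
    have := (Equiv.neg ℤ).hasSum_iff.2 (hasSum_fourier_series_L2 g)
    simp only [Function.comp_def, Equiv.neg_apply, hc] at this
    exact this
  -- Convergence in `L²` is pointwise only along subsequences. The second one is extracted from the
  -- first, so that along it both series converge almost everywhere and the limits can be compared.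
  obtain ⟨ns, hns, hns1⟩ := (tendstoInMeasure_of_tendsto_Lp hs.hasSum).exists_seq_tendsto_ae'
  obtain ⟨ms, hms, hms2⟩ := (tendstoInMeasure_of_tendsto_Lp (h2.comp hns)).exists_seq_tendsto_ae'
  have e2 := coeFn_sum_smul c fun k : ℤ =>
    (fourierLp 2 (-k) : Lp ℂ 2 (@AddCircle.haarAddCircle h _))
  have e3 : ∀ᵐ x ∂(@AddCircle.haarAddCircle h _), ∀ k : ℤ,
      (fourierLp 2 (-k) : Lp ℂ 2 (@AddCircle.haarAddCircle h _)) x = fourier (-k) x :=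
    ae_all_iff.2 fun k => coeFn_fourierLp 2 (-k)
  filter_upwards [hns1, ae_coe_addCircle hms2, coeFn_sum_smul c b, ae_coe_addCircle e2,
    ae_all_iff.2 hb, ae_coe_addCircle e3] with ξ k1 k2 k3 k4 k5 k6
  have l1 := k1.comp hms
  simp only [k3, Function.comp_def] at l1
  simp only [k4, Function.comp_def] at k2
  refine tendsto_nhds_unique l1 ?_
  refine (k2.mul_const (Φ ξ)).congr fun i => ?_
  rw [Finset.sum_mul]
  refine Finset.sum_congr rfl fun k _ => ?_
  rw [k5, k6, fourier_coe_eq_phase]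
  push_cast
  rw [show -(-(k : ℝ) * ξ / h) = k * ξ / h by ring, mul_assoc]

end Periodic

/-! ### Synthesis with shift-invariant Riesz sequences, in the Fourier domain -/

/-- The Fourier transform of the Riesz sequence of the shifts `φ_i(· - k / h)`: a Riesz sequence
`b_(i,k)` given by the modulations `exp(-2πi k ξ / h) Φ_i(ξ)`. -/
structure ModulatedRiesz {ι : Type*} [Fintype ι] (h : ℝ) (Φ : ι → ℝ → ℂ)
    (b : ι × ℤ → Lp ℂ 2 (volume : Measure ℝ)) (A B : ℝ) : Prop where
  pos : 0 < h
  measurable : ∀ i, Measurable (Φ i)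
  ae_eq : ∀ q, b q =ᵐ[volume] fun ξ => phase (q.2 * ξ / h) * Φ q.1 ξ
  lower_pos : 0 < A
  upper_pos : 0 < B
  riesz : ∀ c : ι × ℤ → ℂ, Summable (fun q => ‖c q‖ ^ 2) →
    Summable (fun q => c q • b q) ∧
    A * ∑' q, ‖c q‖ ^ 2 ≤ ‖∑' q, c q • b q‖ ^ 2 ∧
    ‖∑' q, c q • b q‖ ^ 2 ≤ B * ∑' q, ‖c q‖ ^ 2

/-- The coefficients of the `h`-periodic extension of `u` from `(a, a + h]`. -/
def bandCoeff {ι : Type*} (h a : ℝ) (u : ι → ℝ → ℂ) (q : ι × ℤ) : ℂ :=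
  (1 / h : ℝ) • ∫ x in a..a + h, phase (-(q.2 * x / h)) * u q.1 x

section Band

variable {ι : Type*} {h A B : ℝ} {Φ : ι → ℝ → ℂ}
  {b : ι × ℤ → Lp ℂ 2 (volume : Measure ℝ)}

theorem bandCoeff_eq_fourierCoeffOn (hh : 0 < h) (a : ℝ) (u : ι → ℝ → ℂ) (i : ι) (k : ℤ) :
    bandCoeff h a u (i, k) = fourierCoeffOn (lt_add_of_pos_right a hh) (u i) (-k) := by
  rw [fourierCoeffOn_eq_integral, bandCoeff, add_sub_cancel_left]
  congr 1
  refine intervalIntegral.integral_congr fun x _ => ?_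
  simp only [neg_neg, smul_eq_mul]
  congr 1
  rw [fourier_coe_apply, phase]; congr 1; push_cast; ring

variable [Fintype ι]

/-- Parseval on `(a, a + h]` for each component. The resulting square-summability is what allows the
Riesz property to be applied. -/
theorem hasSum_norm_sq_bandCoeff (hh : 0 < h) (a : ℝ) (u : ι → ℝ → ℂ)
    (hu : ∀ i, MemLp (u i) 2 (volume.restrict (Set.Ioc a (a + h)))) :
    HasSum (fun q => ‖bandCoeff h a u q‖ ^ 2) (h⁻¹ * ∑ i, ∫ x in a..a + h, ‖u i x‖ ^ 2) := by
  have key : ∀ i, HasSum (fun k : ℤ => ‖bandCoeff h a u (i, k)‖ ^ 2)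
      (h⁻¹ * ∫ x in a..a + h, ‖u i x‖ ^ 2) := by
    intro i
    have h1 := (Equiv.neg ℤ).hasSum_iff.2
      (hasSum_sq_fourierCoeffOn (lt_add_of_pos_right a hh) (hu i))
    rw [add_sub_cancel_left, smul_eq_mul] at h1
    simp only [bandCoeff_eq_fourierCoeffOn hh]
    exact h1
  have hs : Summable (fun q : ι × ℤ => ‖bandCoeff h a u q‖ ^ 2) :=
    (summable_prod_of_nonneg fun q => by positivity).2
      ⟨fun i => (key i).summable, (hasSum_fintype _).summable⟩
  have h2 := hs.hasSum.prod_fiberwise key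
  rw [Finset.mul_sum, ← h2.unique (hasSum_fintype _)]
  exact hs.hasSum

/-- The value on every band of the series with coefficients `bandCoeff`. -/
theorem ModulatedRiesz.tsum_bandCoeff_ae (hR : ModulatedRiesz h Φ b A B) (a : ℝ) (u : ι → ℝ → ℂ)
    (hu : ∀ i, MemLp (u i) 2 (volume.restrict (Set.Ioc a (a + h)))) :
    ∀ᵐ ξ ∂(volume.restrict (Set.Ioc a (a + h))), ∀ n : ℤ,
      (∑' q, bandCoeff h a u q • b q : Lp ℂ 2 (volume : Measure ℝ)) (ξ + n * h) =
        ∑ i, u i ξ * Φ i (ξ + n * h) := by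
  have : Fact (0 < h) := ⟨hR.pos⟩
  have hL : ∀ i, MemLp (AddCircle.liftIoc h a (u i)) 2 (@AddCircle.haarAddCircle h _) :=
    fun i => (hu i).memLp_liftIoc.haarAddCircle
  have hcoeff : ∀ i (k : ℤ), bandCoeff h a u (i, k) = fourierCoeff ((hL i).toLp _) (-k) := by
    intro i k
    rw [fourierCoeff_congr_ae (hL i).coeFn_toLp, fourierCoeff_liftIoc_eq,
      bandCoeff_eq_fourierCoeffOn hR.pos]
  have hs := (hR.riesz _ (hasSum_norm_sq_bandCoeff hR.pos a u hu).summable).1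
  have h1 : (∑' q, bandCoeff h a u q • b q) =
      ∑ i, ∑' k : ℤ, fourierCoeff ((hL i).toLp _) (-k) • b (i, k) := by
    rw [hs.tsum_prod, tsum_fintype]
    simp_rw [hcoeff]
  have h2 : ∀ i, (∑' k : ℤ, fourierCoeff ((hL i).toLp _) (-k) • b (i, k) :
      Lp ℂ 2 (volume : Measure ℝ)) =ᵐ[volume]
      fun ξ => (hL i).toLp _ (ξ : AddCircle h) * Φ i ξ := by
    intro i
    refine tsum_fourierCoeff_smul_ae (fun k => hR.ae_eq (i, k)) _ ?_
    have := hs.prod_factor i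
    simpa only [hcoeff] using this
  have h3 : ∀ᵐ ξ : ℝ, (∑' q, bandCoeff h a u q • b q : Lp ℂ 2 (volume : Measure ℝ)) ξ =
      ∑ i, AddCircle.liftIoc h a (u i) (ξ : AddCircle h) * Φ i ξ := by
    rw [h1]
    have h5 : ∀ᵐ x ∂(@AddCircle.haarAddCircle h _), ∀ i,
        (hL i).toLp _ x = AddCircle.liftIoc h a (u i) x :=
      ae_all_iff.2 fun i => (hL i).coeFn_toLp
    filter_upwards [Lp.coeFn_fun_finsetSum Finset.univ fun i => ∑' k : ℤ,
      fourierCoeff ((hL i).toLp _) (-k) • b (i, k), ae_all_iff.2 h2, ae_coe_addCircle h5]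
      with ξ k1 k2 k3
    rw [k1]
    refine Finset.sum_congr rfl fun i _ => ?_
    rw [k2, k3]
  -- A translation by `n h` moves `Φ i` but not its periodic multiplier, which equals `u i` on the
  -- base interval.
  have h4 := ae_restrict_of_ae (s := Set.Ioc a (a + h)) (ae_shift h3 h)
  filter_upwards [h4, ae_restrict_mem measurableSet_Ioc] with ξ k1 k2 n
  rw [k1 n]
  refine Finset.sum_congr rfl fun i _ => ?_
  rw [show ((ξ + n * h : ℝ) : AddCircle h) = (ξ : AddCircle h) by
    rw [← zsmul_eq_mul, AddCircle.coe_add, AddCircle.coe_zsmul, AddCircle.coe_period, smul_zero,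
      add_zero], AddCircle.liftIoc_coe_apply k2]

theorem enorm_sq_eq_lintegral (f : Lp ℂ 2 (volume : Measure ℝ)) :
    ‖f‖ₑ ^ 2 = ∫⁻ x, ‖f x‖ₑ ^ 2 := by
  rw [Lp.enorm_def, eLpNorm_eq_lintegral_rpow_enorm_toReal (by norm_num) (by norm_num),
    ← ENNReal.rpow_natCast, ← ENNReal.rpow_mul]
  simp

/-- The distance of a function to the series with coefficients `bandCoeff`. -/
theorem ModulatedRiesz.enorm_sub_sq (hR : ModulatedRiesz h Φ b A B) (a : ℝ) (u : ι → ℝ → ℂ)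
    (hu : ∀ i, MemLp (u i) 2 (volume.restrict (Set.Ioc a (a + h))))
    (F : Lp ℂ 2 (volume : Measure ℝ)) :
    ‖F - ∑' q, bandCoeff h a u q • b q‖ₑ ^ 2 = ∫⁻ ξ in Set.Ioc a (a + h), ∑' n : ℤ,
      ‖F (ξ + n * h) - ∑ i, u i ξ * Φ i (ξ + n * h)‖ₑ ^ 2 := by
  rw [enorm_sq_eq_lintegral, lintegral_eq_lintegral_Ioc_tsum hR.pos a
    ((Lp.aestronglyMeasurable _).enorm.pow_const _)]
  refine lintegral_congr_ae ?_
  filter_upwards [hR.tsum_bandCoeff_ae a u hu, ae_restrict_of_ae (ae_shift (Lp.coeFn_sub F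
    (∑' q, bandCoeff h a u q • b q)) h)] with ξ h1 h2
  refine tsum_congr fun n => ?_
  rw [h2, Pi.sub_apply, h1]

end Band

/-! ### Gram matrices of square-summable families of vectors -/

section Gram

variable {ι : Type*} [Fintype ι]

/-- The Gram matrix `∑ₙ xₙ xₙ*` of a family of vectors. -/
def gramSum (x : ℤ → ι → ℂ) : Matrix ι ι ℂ := Matrix.of fun i j => ∑' n, x n i * conj (x n j)

omit [Fintype ι] in
theorem summable_mul_conj {x : ℤ → ι → ℂ} (hx : ∀ i, Summable fun n => ‖x n i‖ ^ 2) (i j : ι) :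
    Summable fun n => x n i * conj (x n j) := by
  refine Summable.of_norm_bounded ((hx i).add (hx j)) fun n => ?_
  rw [norm_mul, RCLike.norm_conj]
  nlinarith [sq_nonneg (‖x n i‖ - ‖x n j‖), sq_nonneg (‖x n i‖), sq_nonneg ‖x n j‖]

/-- Expansion of `|w* xₙ|²` as a double sum; it also shows that the quadratic form is real and
nonnegative. -/
theorem hasSum_gramSum {x : ℤ → ι → ℂ} (hx : ∀ i, Summable fun n => ‖x n i‖ ^ 2) (w : ι → ℂ) :
    HasSum (fun n => ((‖∑ i, conj (w i) * x n i‖ ^ 2 : ℝ) : ℂ)) (star w ⬝ᵥ gramSum x *ᵥ w) := by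
  have h1 : HasSum (fun n => ∑ i, ∑ j, conj (w i) * (x n i * conj (x n j) * w j))
      (∑ i, ∑ j, conj (w i) * (gramSum x i j * w j)) :=
    hasSum_sum fun i _ => hasSum_sum fun j _ =>
      ((summable_mul_conj hx i j).hasSum.mul_right _).mul_left _
  convert h1 using 1
  · funext n
    rw [Complex.ofReal_pow, ← Complex.mul_conj', map_sum, Finset.sum_mul_sum]
    refine Finset.sum_congr rfl fun i _ => Finset.sum_congr rfl fun j _ => ?_
    rw [map_mul, Complex.conj_conj]; ring
  · simp only [dotProduct, Matrix.mulVec, Pi.star_apply, RCLike.star_def, Finset.mul_sum]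

omit [Fintype ι] in
theorem gramSum_isHermitian (x : ℤ → ι → ℂ) : (gramSum x).IsHermitian := by
  ext i j
  simp only [gramSum, Matrix.conjTranspose_apply, Matrix.of_apply, RCLike.star_def]
  rw [Complex.conj_tsum]
  refine tsum_congr fun n => ?_
  rw [map_mul, Complex.conj_conj, mul_comm]

/-- On a kernel vector `w` the quadratic form vanishes, so the lower bound at `conj w` forces `w =
0`. -/
theorem gramSum_isUnit_det [DecidableEq ι] {x : ℤ → ι → ℂ}
    (hx : ∀ i, Summable fun n => ‖x n i‖ ^ 2) {α : ℝ} (hα : 0 < α)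
    (hlow : ∀ v : ι → ℂ, α * ∑ i, ‖v i‖ ^ 2 ≤ ∑' n, ‖∑ i, v i * x n i‖ ^ 2) :
    IsUnit (gramSum x).det := by
  rw [isUnit_iff_ne_zero]
  intro h0
  obtain ⟨w, hw, hw0⟩ := Matrix.exists_mulVec_eq_zero_iff.2 h0
  have h1 := hasSum_gramSum hx w
  rw [hw0, dotProduct_zero] at h1
  have h2 : HasSum (fun n => ‖∑ i, conj (w i) * x n i‖ ^ 2) 0 := by
    simpa only [Complex.ofReal_re, Complex.zero_re] using Complex.hasSum_re h1
  have h3 := hlow fun i => conj (w i)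
  rw [h2.tsum_eq] at h3
  simp only [RCLike.norm_conj] at h3
  apply hw
  funext i
  have h4 : ‖w i‖ ^ 2 ≤ ∑ i, ‖w i‖ ^ 2 :=
    Finset.single_le_sum (f := fun i => ‖w i‖ ^ 2) (fun i _ => by positivity) (Finset.mem_univ i)
  have h5 : ‖w i‖ ^ 2 ≤ 0 := by nlinarith
  simpa using h5

/-- The error kernel as a sum of squares. -/
theorem hasSum_kernel [DecidableEq ι] {x : ℤ → ι → ℂ} {h : ℝ} (hh : 0 < h)
    (hx : ∀ i, Summable fun n => ‖x n i‖ ^ 2) (hdet : IsUnit (gramSum x).det)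
    {G : Matrix ι ι ℂ} (hG : G = (h : ℂ) • gramSum x) (ψ : ι → ℂ) :
    HasSum (fun n : ℤ => ‖(if n = 0 then 1 else 0) - h * ∑ i, conj (ψ i) * x n i‖ ^ 2)
      (1 - h * (star (x 0) ⬝ᵥ (G⁻¹ *ᵥ x 0)).re +
        h * (star (ψ - G⁻¹ *ᵥ x 0) ⬝ᵥ (G *ᵥ (ψ - G⁻¹ *ᵥ x 0))).re) := by
  have hGdet : IsUnit G.det := by
    rw [hG, Matrix.det_smul]
    exact ((isUnit_iff_ne_zero.2 (by exact_mod_cast hh.ne')).pow _).mul hdet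
  have hGh : G.IsHermitian := by
    rw [hG, Matrix.IsHermitian, Matrix.conjTranspose_smul, (gramSum_isHermitian x).eq]
    simp
  set φ := x 0 with hφ
  have hGG : G *ᵥ (G⁻¹ *ᵥ φ) = φ := by
    rw [Matrix.mulVec_mulVec, Matrix.mul_nonsing_inv _ hGdet, Matrix.one_mulVec]
  have hcross : star (G⁻¹ *ᵥ φ) ⬝ᵥ (G *ᵥ ψ) = star φ ⬝ᵥ ψ := by
    rw [Matrix.star_mulVec, hGh.inv.eq, Matrix.dotProduct_mulVec, Matrix.vecMul_vecMul,
      Matrix.nonsing_inv_mul _ hGdet, Matrix.vecMul_one]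
  have hquad : star (G⁻¹ *ᵥ φ) ⬝ᵥ φ = star φ ⬝ᵥ (G⁻¹ *ᵥ φ) := by
    rw [Matrix.star_mulVec, hGh.inv.eq, ← Matrix.dotProduct_mulVec]
  have hre : (star φ ⬝ᵥ ψ).re = (star ψ ⬝ᵥ φ).re := by
    rw [← Complex.conj_re, ← RCLike.star_def, ← Matrix.star_dotProduct_star]
    simp [dotProduct_comm]
  -- The two terms `φ* G⁻¹ φ` cancel, leaving an expression without the inverse of `G`.
  have hval : (1 - h * (star φ ⬝ᵥ (G⁻¹ *ᵥ φ)).re +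
        h * (star (ψ - G⁻¹ *ᵥ φ) ⬝ᵥ (G *ᵥ (ψ - G⁻¹ *ᵥ φ))).re) =
      (1 - 2 * h * (star ψ ⬝ᵥ φ).re) + h * (star ψ ⬝ᵥ G *ᵥ ψ).re := by
    rw [Matrix.mulVec_sub, star_sub, sub_dotProduct, dotProduct_sub, dotProduct_sub, hGG, hcross,
      hquad]
    simp only [Complex.sub_re, hre]
    ring
  rw [hval]
  have h1 : HasSum (fun n => ‖∑ i, conj (ψ i) * x n i‖ ^ 2) (star ψ ⬝ᵥ gramSum x *ᵥ ψ).re := by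
    have := Complex.hasSum_re (hasSum_gramSum hx ψ)
    simpa only [Complex.ofReal_re] using this
  have h2 : h * (star ψ ⬝ᵥ G *ᵥ ψ).re = h ^ 2 * (star ψ ⬝ᵥ gramSum x *ᵥ ψ).re := by
    rw [hG, Matrix.smul_mulVec, dotProduct_smul, smul_eq_mul, Complex.re_ofReal_mul]; ring
  rw [h2]
  have h3 : HasSum (fun n : ℤ => if n = 0 then (1 - 2 * h * (star ψ ⬝ᵥ φ).re) else 0)
      (1 - 2 * h * (star ψ ⬝ᵥ φ).re) := hasSum_ite_eq 0 _
  -- Only the term `n = 0` has a cross term: `|1 - h z|² = 1 - 2 h Re z + h² |z|²`.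
  convert h3.add (h1.mul_left (h ^ 2)) using 1
  funext n
  by_cases hn : n = 0
  · have hz : star ψ ⬝ᵥ φ = ∑ i, conj (ψ i) * x n i := by rw [hφ, hn]; rfl
    rw [if_pos hn, if_pos hn, hz]
    simp only [Complex.sq_norm, Complex.normSq_apply, Complex.sub_re, Complex.sub_im,
      Complex.re_ofReal_mul, Complex.im_ofReal_mul, Complex.one_re, Complex.one_im]
    ring
  · rw [if_neg hn, if_neg hn, zero_sub, norm_neg, norm_mul, Complex.norm_real, mul_pow,
      Real.norm_eq_abs, sq_abs, zero_add]

/-- Write `h z_n = δ_n - (δ_n - h z_n)`, use `(p + q)² ≤ 2p² + 2q²` and sum over `n`; the lower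
frame bound then recovers `ψ` from the `z_n`. -/
theorem kernel_bound {x : ℤ → ι → ℂ} {h α : ℝ} (hh : 0 < h)
    (hx : ∀ i, Summable fun n => ‖x n i‖ ^ 2)
    (hlow : ∀ v : ι → ℂ, α * ∑ i, ‖v i‖ ^ 2 ≤ ∑' n, ‖∑ i, v i * x n i‖ ^ 2) (ψ : ι → ℂ) {K : ℝ}
    (hK : HasSum (fun n : ℤ => ‖(if n = 0 then 1 else 0) - h * ∑ i, conj (ψ i) * x n i‖ ^ 2) K) :
    h ^ 2 * (α * ∑ i, ‖ψ i‖ ^ 2) ≤ 2 + 2 * K := by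
  have h1 : HasSum (fun n => ‖∑ i, conj (ψ i) * x n i‖ ^ 2) (star ψ ⬝ᵥ gramSum x *ᵥ ψ).re := by
    have := Complex.hasSum_re (hasSum_gramSum hx ψ)
    simpa only [Complex.ofReal_re] using this
  have h2 := hlow fun i => conj (ψ i)
  simp only [RCLike.norm_conj] at h2
  rw [h1.tsum_eq] at h2
  have h3 : HasSum (fun n : ℤ => if n = 0 then (2 : ℝ) else 0) 2 := hasSum_ite_eq 0 _
  have h4 := hasSum_le (fun n => ?_) (h1.mul_left (h ^ 2)) (h3.add (hK.mul_left 2))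
  · exact (mul_le_mul_of_nonneg_left h2 (by positivity)).trans h4
  · set z := ∑ i, conj (ψ i) * x n i
    have e1 : ‖(h : ℂ) * z‖ ≤ ‖(if n = 0 then 1 else 0 : ℂ)‖ +
        ‖(if n = 0 then 1 else 0 : ℂ) - h * z‖ := by
      simpa [norm_sub_rev] using norm_sub_le (if n = 0 then 1 else 0 : ℂ)
        ((if n = 0 then 1 else 0 : ℂ) - h * z)
    have e2 : h ^ 2 * ‖z‖ ^ 2 = ‖(h : ℂ) * z‖ ^ 2 := by
      rw [norm_mul, Complex.norm_real, mul_pow, Real.norm_eq_abs, sq_abs]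
    have e3 : (if n = 0 then (2 : ℝ) else 0) = 2 * ‖(if n = 0 then 1 else 0 : ℂ)‖ ^ 2 := by
      split_ifs <;> simp
    rw [e2, e3]
    set p := ‖(if n = 0 then 1 else 0 : ℂ)‖
    set q := ‖(if n = 0 then 1 else 0 : ℂ) - h * z‖
    have : ‖(h : ℂ) * z‖ ^ 2 ≤ (p + q) ^ 2 := by gcongr
    nlinarith [sq_nonneg (p - q)]

end Gram

/-! ### Pointwise frame bounds -/

section Frame

variable {ι : Type*} [Fintype ι] {h A B : ℝ} {Φ : ι → ℝ → ℂ}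
  {b : ι × ℤ → Lp ℂ 2 (volume : Measure ℝ)}

theorem ModulatedRiesz.enorm_tsum_sq (hR : ModulatedRiesz h Φ b A B) (a : ℝ) (u : ι → ℝ → ℂ)
    (hu : ∀ i, MemLp (u i) 2 (volume.restrict (Set.Ioc a (a + h)))) :
    ‖∑' q, bandCoeff h a u q • b q‖ₑ ^ 2 = ∫⁻ ξ in Set.Ioc a (a + h), ∑' n : ℤ,
      ‖∑ i, u i ξ * Φ i (ξ + n * h)‖ₑ ^ 2 := by
  rw [enorm_sq_eq_lintegral, lintegral_eq_lintegral_Ioc_tsum hR.pos a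
    ((Lp.aestronglyMeasurable _).enorm.pow_const _)]
  refine lintegral_congr_ae ?_
  filter_upwards [hR.tsum_bandCoeff_ae a u hu] with ξ h1
  exact tsum_congr fun n => by rw [h1]

theorem ofReal_norm_sq {E : Type*} [NormedAddCommGroup E] (x : E) :
    ENNReal.ofReal (‖x‖ ^ 2) = ‖x‖ₑ ^ 2 := by
  rw [ENNReal.ofReal_pow (norm_nonneg _), ofReal_norm]

theorem ModulatedRiesz.measurable_tsum (hR : ModulatedRiesz h Φ b A B) (v : ι → ℂ) :
    Measurable fun ξ : ℝ => ∑' n : ℤ, ‖∑ i, v i * Φ i (ξ + n * h)‖ₑ ^ 2 := by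
  refine Measurable.tsum fun n => Measurable.pow_const (Measurable.enorm ?_) _
  exact Finset.measurable_fun_sum _ fun i _ =>
    ((hR.measurable i).comp (measurable_id.add_const _)).const_mul _

/-- The Riesz inequalities are tested on coefficients of `v` times the indicator of an arbitrary
measurable subset `t` of a period. Bounds on all the integrals over `t` are bounds almost
everywhere. -/
theorem ModulatedRiesz.ae_bounds (hR : ModulatedRiesz h Φ b A B) (v : ι → ℂ) : ∀ᵐ ξ : ℝ,
    ENNReal.ofReal (A / h * ∑ i, ‖v i‖ ^ 2) ≤ ∑' n : ℤ, ‖∑ i, v i * Φ i (ξ + n * h)‖ₑ ^ 2 ∧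
    ∑' n : ℤ, ‖∑ i, v i * Φ i (ξ + n * h)‖ₑ ^ 2 ≤ ENNReal.ofReal (B / h * ∑ i, ‖v i‖ ^ 2) := by
  have hh := hR.pos
  refine ae_of_forall_ae_Ioc hh fun a => ?_
  set μ := volume.restrict (Set.Ioc a (a + h)) with hμ
  set W := fun ξ : ℝ => ∑' n : ℤ, ‖∑ i, v i * Φ i (ξ + n * h)‖ₑ ^ 2 with hW
  have key : ∀ t : Set ℝ, MeasurableSet t →
      ∫⁻ _ in t, ENNReal.ofReal (A / h * ∑ i, ‖v i‖ ^ 2) ∂μ ≤ ∫⁻ ξ in t, W ξ ∂μ ∧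
      ∫⁻ ξ in t, W ξ ∂μ ≤ ∫⁻ _ in t, ENNReal.ofReal (B / h * ∑ i, ‖v i‖ ^ 2) ∂μ := by
    intro t ht
    set u : ι → ℝ → ℂ := fun i => t.indicator fun _ => v i with hu
    have hum : ∀ i, MemLp (u i) 2 μ := fun i => (memLp_const (v i)).indicator ht
    have hc := hasSum_norm_sq_bandCoeff hh a u hum
    obtain ⟨-, h1, h2⟩ := hR.riesz _ hc.summable
    have hint : ∀ i, ∫ x in a..a + h, ‖u i x‖ ^ 2 = μ.real t * ‖v i‖ ^ 2 := by
      intro i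
      rw [intervalIntegral.integral_of_le (by linarith)]
      have : ∀ x, ‖u i x‖ ^ 2 = t.indicator (fun _ => ‖v i‖ ^ 2) x := by
        intro x
        by_cases hx : x ∈ t <;> simp [hu, hx]
      simp_rw [this]
      rw [integral_indicator_const _ ht, smul_eq_mul]
    rw [hc.tsum_eq] at h1 h2
    simp_rw [hint, ← Finset.mul_sum] at h1 h2
    have h3 := hR.enorm_tsum_sq a u hum
    have h4 : ∫⁻ ξ in Set.Ioc a (a + h), ∑' n : ℤ, ‖∑ i, u i ξ * Φ i (ξ + n * h)‖ₑ ^ 2 =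
        ∫⁻ ξ in t, W ξ ∂μ := by
      rw [← lintegral_indicator ht]
      refine lintegral_congr fun ξ => ?_
      by_cases hx : ξ ∈ t <;> simp [hu, hx, hW]
    have e : ∀ D : ℝ, 0 < D → ∫⁻ _ in t, ENNReal.ofReal (D / h * ∑ i, ‖v i‖ ^ 2) ∂μ =
        ENNReal.ofReal (D * (h⁻¹ * (μ.real t * ∑ i, ‖v i‖ ^ 2))) := by
      intro D hD
      rw [setLIntegral_const, ← ENNReal.ofReal_toReal (measure_ne_top μ t),
        ← ENNReal.ofReal_mul (by positivity)]
      congr 1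
      simp only [Measure.real]; ring
    rw [e A hR.lower_pos, e B hR.upper_pos, ← h4, ← h3, ← ofReal_norm_sq]
    exact ⟨ENNReal.ofReal_le_ofReal h1, ENNReal.ofReal_le_ofReal h2⟩
  have k1 := ae_le_of_forall_setLIntegral_le_of_sigmaFinite (μ := μ) measurable_const
    (g := W) fun t ht _ => (key t ht).1
  have k2 := ae_le_of_forall_setLIntegral_le_of_sigmaFinite (μ := μ) (hR.measurable_tsum v)
    fun t ht _ => (key t ht).2
  filter_upwards [k1, k2] with ξ h1 h2 using ⟨h1, h2⟩

/-- The frame bounds of the fibers of `Φ`. -/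
theorem ModulatedRiesz.ae_frame (hR : ModulatedRiesz h Φ b A B) : ∀ᵐ ξ : ℝ,
    (∀ i, Summable fun n : ℤ => ‖Φ i (ξ + n * h)‖ ^ 2) ∧
    ∀ v : ι → ℂ, A / h * ∑ i, ‖v i‖ ^ 2 ≤ ∑' n : ℤ, ‖∑ i, v i * Φ i (ξ + n * h)‖ ^ 2 := by
  classical
  -- The null set depends on `v`, so the bounds are first taken on a dense sequence; the coordinate
  -- vectors provide summability of the fibres.
  have h1 := ae_all_iff.2 fun n : ℕ => hR.ae_bounds (TopologicalSpace.denseSeq (ι → ℂ) n)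
  have h2 := ae_all_iff.2 fun i : ι => hR.ae_bounds (Pi.single i 1)
  filter_upwards [h1, h2] with ξ k1 k2
  have hs : ∀ i, Summable fun n : ℤ => ‖Φ i (ξ + n * h)‖ ^ 2 := by
    intro i
    have := ((k2 i).2.trans_lt ENNReal.ofReal_lt_top).ne
    simp only [Pi.single_apply, ite_mul, one_mul, zero_mul, Finset.sum_ite_eq', Finset.mem_univ,
      if_true, ← ofReal_norm_sq] at this
    have h3 := ENNReal.summable_toReal this
    simpa only [ENNReal.toReal_ofReal (sq_nonneg _)] using h3
  refine ⟨hs, ?_⟩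
  have hform : ∀ v : ι → ℂ, HasSum (fun n : ℤ => ‖∑ i, v i * Φ i (ξ + n * h)‖ ^ 2)
      (star (star v) ⬝ᵥ gramSum (fun n : ℤ => fun i => Φ i (ξ + n * h)) *ᵥ star v).re := by
    intro v
    have := Complex.hasSum_re (hasSum_gramSum (x := fun (n : ℤ) i => Φ i (ξ + n * h)) hs (star v))
    simpa only [Complex.ofReal_re, Pi.star_apply, RCLike.star_def, Complex.conj_conj] using this
  -- Once summability is known, both sides are finite quadratic forms, continuous in `v`, and the
  -- inequality passes to the closure.
  have hcl : IsClosed {v : ι → ℂ | A / h * ∑ i, ‖v i‖ ^ 2 ≤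
      (star (star v) ⬝ᵥ gramSum (fun (n : ℤ) i => Φ i (ξ + n * h)) *ᵥ star v).re} := by
    refine isClosed_le (by fun_prop) ?_
    simp only [dotProduct, Matrix.mulVec]
    fun_prop
  intro v
  rw [(hform v).tsum_eq]
  refine (TopologicalSpace.denseRange_denseSeq (ι → ℂ)).induction_on
    (p := fun v : ι → ℂ => A / h * ∑ i, ‖v i‖ ^ 2 ≤
      (star (star v) ⬝ᵥ gramSum (fun (n : ℤ) i => Φ i (ξ + n * h)) *ᵥ star v).re) v hcl ?_
  intro n
  have h3 := (k1 n).1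
  simp_rw [← ofReal_norm_sq] at h3
  rw [← ENNReal.ofReal_tsum_of_nonneg (fun n => by positivity) (hform _).summable,
    (hform _).tsum_eq] at h3
  refine (ENNReal.ofReal_le_ofReal_iff ?_).1 h3
  exact (hform _).nonneg fun n => by positivity

end Frame

/-! ### Frequency bands -/

section Bands

variable {h : ℝ}

/-- The left endpoint of the `n`-th frequency band. -/
def bandStart (h : ℝ) (n : ℤ) : ℝ := n * h - h / 2

/-- The `n`-th frequency band, of width `h` and centered at `n h`. -/
def band (h : ℝ) (n : ℤ) : Set ℝ := Set.Ioc (bandStart h n) (bandStart h n + h)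

theorem measurableSet_band (n : ℤ) : MeasurableSet (band h n) := measurableSet_Ioc

theorem band_eq (h : ℝ) :
    band h = fun n : ℤ => Set.Ioc (-(h / 2) + n • h) (-(h / 2) + (n + 1) • h) := by
  funext n
  simp only [band, bandStart, zsmul_eq_mul]
  push_cast
  congr 1 <;> ring

theorem iUnion_band (hh : 0 < h) : ⋃ n, band h n = Set.univ := by
  rw [band_eq]; exact iUnion_Ioc_add_zsmul hh _

theorem pairwise_disjoint_band (h : ℝ) : Pairwise (Function.onFun Disjoint (band h)) := by
  rw [band_eq]; exact Set.pairwise_disjoint_Ioc_add_zsmul _ _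

theorem hasSum_setIntegral_band (hh : 0 < h) {E : Type*} [NormedAddCommGroup E] [NormedSpace ℝ E]
    {g : ℝ → E} (hg : Integrable g) : HasSum (fun n => ∫ ξ in band h n, g ξ) (∫ ξ, g ξ) := by
  have := hasSum_integral_iUnion (μ := volume) (f := g) (s := band h) measurableSet_band
    (pairwise_disjoint_band h) hg.integrableOn
  rwa [iUnion_band hh, setIntegral_univ] at this

/-- For `|n| ≥ 1` the half width of the band is at most half the distance `|n| h` of its centre from
`0`. -/
theorem sq_le_of_mem_band (hh : 0 < h) {n : ℤ} (hn : n ≠ 0) {ξ : ℝ} (hξ : ξ ∈ band h n) :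
    (n : ℝ) ^ 2 * h ^ 2 / 4 ≤ ξ ^ 2 := by
  obtain ⟨h1, h2⟩ := hξ
  simp only [bandStart] at h1 h2
  have : (n : ℝ) ^ 2 * h ^ 2 / 4 = (n * h / 2) ^ 2 := by ring
  rw [this, sq_le_sq]
  rcases lt_or_gt_of_ne hn with hn | hn
  · have h3 : (n : ℝ) ≤ -1 := by exact_mod_cast Int.le_sub_one_of_lt hn
    have h4 : ξ ≤ n * h / 2 := by nlinarith
    have h5 : n * h / 2 ≤ 0 := by nlinarith
    rw [abs_of_nonpos h5, abs_of_nonpos (h4.trans h5)]; linarith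
  · have h3 : (1 : ℝ) ≤ n := by exact_mod_cast hn
    have h4 : n * h / 2 ≤ ξ := by nlinarith
    have h5 : 0 ≤ n * h / 2 := by nlinarith
    rw [abs_of_nonneg h5, abs_of_nonneg (h5.trans h4)]; linarith

/-- A half-open interval of length `h` contains one point of each class modulo `h`: there is no
aliasing inside a band. -/
theorem add_mem_band_iff (hh : 0 < h) {n m : ℤ} {ξ : ℝ} (hξ : ξ ∈ band h n) :
    ξ + m * h ∈ band h n ↔ m = 0 := by
  refine ⟨fun hm => ?_, fun hm => by simpa [hm] using hξ⟩
  obtain ⟨h1, h2⟩ := hξ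
  obtain ⟨h3, h4⟩ := hm
  have h5 : (m : ℝ) < 1 := by
    by_contra! hc
    nlinarith
  have h6 : (-1 : ℝ) < m := by
    by_contra! hc
    nlinarith
  have h7 : m < 1 := by exact_mod_cast h5
  have h8 : -1 < m := by exact_mod_cast h6
  omega

/-- The restriction of a square-integrable function to a band. -/
def bandPart (h : ℝ) (F : Lp ℂ 2 (volume : Measure ℝ)) (n : ℤ) : Lp ℂ 2 (volume : Measure ℝ) :=
  ((Lp.memLp F).indicator (measurableSet_band (h := h) n)).toLp _

theorem bandPart_ae (F : Lp ℂ 2 (volume : Measure ℝ)) (n : ℤ) :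
    bandPart h F n =ᵐ[volume] (band h n).indicator F := MemLp.coeFn_toLp _

theorem integrable_norm_sq (F : Lp ℂ 2 (volume : Measure ℝ)) : Integrable fun ξ => ‖F ξ‖ ^ 2 :=
  (memLp_two_iff_integrable_sq_norm (Lp.aestronglyMeasurable F)).1 (Lp.memLp F)

theorem norm_sq_eq_integral (F : Lp ℂ 2 (volume : Measure ℝ)) : ‖F‖ ^ 2 = ∫ ξ, ‖F ξ‖ ^ 2 := by
  have h1 := enorm_sq_eq_lintegral F
  simp_rw [← ofReal_norm_sq] at h1
  rw [← ofReal_integral_eq_lintegral_ofReal (integrable_norm_sq F)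
    (Eventually.of_forall fun _ => by positivity)] at h1
  exact (ENNReal.ofReal_eq_ofReal_iff (by positivity)
    (integral_nonneg fun _ => by positivity)).1 h1

theorem norm_sq_bandPart (F : Lp ℂ 2 (volume : Measure ℝ)) (n : ℤ) :
    ‖bandPart h F n‖ ^ 2 = ∫ ξ in band h n, ‖F ξ‖ ^ 2 := by
  rw [norm_sq_eq_integral, ← integral_indicator (measurableSet_band n)]
  refine integral_congr_ae ((bandPart_ae (h := h) F n).mono fun ξ hξ => ?_)
  simp only [hξ]
  by_cases hx : ξ ∈ band h n <;> simp [hx]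

/-- An absolutely convergent series in `L²` also converges almost everywhere to its sum, and at each
point only one band contributes. -/
theorem hasSum_bandPart (hh : 0 < h) (F : Lp ℂ 2 (volume : Measure ℝ))
    (hs : Summable fun n => ‖bandPart h F n‖) : HasSum (bandPart h F) F := by
  have h1 : ∑' n, ‖bandPart h F n‖ₑ ≠ ∞ := tsum_enorm_ne_top_iff_summable_norm.2 hs
  have h2 : ∑' n, bandPart h F n = F := by
    refine Lp.ext ?_
    filter_upwards [Lp.hasSum_coeFn_tsum h1, ae_all_iff.2 (bandPart_ae (h := h) F)] with ξ k1 k2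
    simp only [k2] at k1
    refine k1.unique ?_
    obtain ⟨n, hn⟩ := Set.mem_iUnion.1 ((iUnion_band hh).symm ▸ Set.mem_univ ξ : ξ ∈ ⋃ n, band h n)
    have := hasSum_single (f := fun n => (band h n).indicator F ξ) n fun m hm => by
      refine Set.indicator_of_notMem (fun hc => ?_) _
      exact Set.disjoint_left.1 (pairwise_disjoint_band h hm) hc hn
    simpa [hn] using this
  have h3 := hs.of_norm.hasSum
  rwa [h2] at h3

/-! ### Weights -/

/-- The weight `max(1, ξ^(2p))`. -/
def polyWeight (p : ℕ) (ξ : ℝ) : ℝ := max 1 ((ξ ^ 2) ^ p)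

theorem one_le_polyWeight (p : ℕ) (ξ : ℝ) : 1 ≤ polyWeight p ξ := le_max_left _ _

theorem continuous_polyWeight (p : ℕ) : Continuous (polyWeight p) := by
  unfold polyWeight; fun_prop

/-- Since `p ≤ L`, the Sobolev weight leaves a spare factor `1 + ξ²`, which later pays for the
absolute convergence of the pairing integrals. -/
theorem polyWeight_mul_le {p L : ℕ} (hpL : p ≤ L) (ξ : ℝ) :
    polyWeight p ξ * (1 + ξ ^ 2) ≤ 2 * (1 + (ξ ^ 2) ^ (L + 1)) := by
  unfold polyWeight
  have ht : 0 ≤ ξ ^ 2 := sq_nonneg _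
  set t := ξ ^ 2
  have h0 : 0 ≤ t ^ (L + 1) := by positivity
  rcases le_total t 1 with h1 | h1
  · rw [max_eq_left (pow_le_one₀ ht h1)]; linarith
  · have h2 : t ^ p ≤ t ^ L := pow_le_pow_right₀ h1 hpL
    have h3 : 1 ≤ t ^ L := one_le_pow₀ h1
    have h4 : max 1 (t ^ p) ≤ t ^ L := max_le h3 h2
    calc max 1 (t ^ p) * (1 + t) ≤ t ^ L * (2 * t) := by gcongr; linarith
      _ = 2 * t ^ (L + 1) := by ring
      _ ≤ _ := by linarith

/-- The spare power of `ξ²` buys the decay `n⁻²`, because `1 ≤ n⁻² (4 / h²) ξ²` on the band. -/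
theorem polyWeight_le_of_mem_band {p L : ℕ} (hpL : p ≤ L) (hh : 0 < h) {n : ℤ} (hn : n ≠ 0) {ξ : ℝ}
    (hξ : ξ ∈ band h n) :
    polyWeight p ξ ≤
      max 1 (4 / h ^ 2) ^ L * (4 / h ^ 2) * (((n : ℝ) ^ 2)⁻¹ * (ξ ^ 2) ^ (L + 1)) := by
  have h1 := sq_le_of_mem_band hh hn hξ
  have hn1 : (1 : ℝ) ≤ (n : ℝ) ^ 2 := by
    have : (1 : ℤ) ≤ n ^ 2 := Int.add_one_le_of_lt (sq_pos_of_ne_zero hn)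
    exact_mod_cast this
  have hn0 : (0 : ℝ) < (n : ℝ) ^ 2 := by linarith
  unfold polyWeight
  have ht : 0 ≤ ξ ^ 2 := sq_nonneg _
  set t := ξ ^ 2
  -- With this `κ`, both `κ ≥ 1` and `κ t ≥ 1` hold, so the exponent `p` may be raised to `L`.
  set κ := max 1 (4 / h ^ 2)
  have hκ1 : 1 ≤ κ := le_max_left _ _
  have h2 : (n : ℝ) ^ 2 ≤ 4 / h ^ 2 * t := by
    rw [div_mul_eq_mul_div, le_div_iff₀ (by positivity)]; linarith
  have h3 : 1 ≤ κ * t := hn1.trans (h2.trans (by gcongr; exact le_max_right _ _))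
  have h4 : t ^ p ≤ (κ * t) ^ p := by gcongr; nlinarith
  have h5 : max 1 (t ^ p) ≤ (κ * t) ^ L :=
    max_le (one_le_pow₀ h3) (h4.trans (pow_le_pow_right₀ h3 hpL))
  have h6 : 1 ≤ ((n : ℝ) ^ 2)⁻¹ * (4 / h ^ 2 * t) := by
    rw [inv_mul_eq_div, one_le_div hn0]; exact h2
  calc max 1 (t ^ p) ≤ (κ * t) ^ L * 1 := by rw [mul_one]; exact h5
    _ ≤ (κ * t) ^ L * (((n : ℝ) ^ 2)⁻¹ * (4 / h ^ 2 * t)) := by gcongr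
    _ = _ := by rw [mul_pow]; ring

theorem integrable_polyWeight_mul {p L : ℕ} (hpL : p ≤ L) (F : Lp ℂ 2 (volume : Measure ℝ))
    (hF : Integrable fun ξ => (ξ ^ 2) ^ (L + 1) * ‖F ξ‖ ^ 2) :
    Integrable fun ξ => polyWeight p ξ * (1 + ξ ^ 2) * ‖F ξ‖ ^ 2 := by
  refine (((integrable_norm_sq F).add hF).const_mul 2).mono' ?_ (Eventually.of_forall fun ξ => ?_)
  · exact (((continuous_polyWeight p).mul (by fun_prop)).aestronglyMeasurable).mul
      ((Lp.aestronglyMeasurable F).norm.pow 2)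
  · have h1 := one_le_polyWeight p ξ
    rw [Real.norm_of_nonneg (by positivity)]
    have := mul_le_mul_of_nonneg_right (polyWeight_mul_le hpL ξ) (sq_nonneg ‖F ξ‖)
    simp only [Pi.add_apply]
    linarith

theorem integrable_polyWeight {p L : ℕ} (hpL : p ≤ L) (F : Lp ℂ 2 (volume : Measure ℝ))
    (hF : Integrable fun ξ => (ξ ^ 2) ^ (L + 1) * ‖F ξ‖ ^ 2) :
    Integrable fun ξ => polyWeight p ξ * ‖F ξ‖ ^ 2 := by
  refine (integrable_polyWeight_mul hpL F hF).mono' ?_ (Eventually.of_forall fun ξ => ?_)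
  · exact (continuous_polyWeight p).aestronglyMeasurable.mul
      ((Lp.aestronglyMeasurable F).norm.pow 2)
  · have h1 := one_le_polyWeight p ξ
    rw [Real.norm_of_nonneg (by positivity)]
    gcongr
    nlinarith [sq_nonneg ξ]

/-- The weighted norm of `F` on a band. -/
def bandNorm (h : ℝ) (p : ℕ) (F : ℝ → ℂ) (n : ℤ) : ℝ :=
  Real.sqrt (∫ ξ in band h n, polyWeight p ξ * ‖F ξ‖ ^ 2)

theorem bandNorm_le {p L : ℕ} (hpL : p ≤ L) (hh : 0 < h) (F : Lp ℂ 2 (volume : Measure ℝ))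
    (hF : Integrable fun ξ => (ξ ^ 2) ^ (L + 1) * ‖F ξ‖ ^ 2) {n : ℤ} (hn : n ≠ 0) :
    bandNorm h p F n ≤ Real.sqrt (max 1 (4 / h ^ 2) ^ L * (4 / h ^ 2)) *
      (|(n : ℝ)|⁻¹ * Real.sqrt (∫ ξ in band h n, (ξ ^ 2) ^ (L + 1) * ‖F ξ‖ ^ 2)) := by
  have e : |(n : ℝ)|⁻¹ = Real.sqrt (((n : ℝ) ^ 2)⁻¹) := by rw [Real.sqrt_inv, Real.sqrt_sq_eq_abs]
  rw [e, ← Real.sqrt_mul (by positivity), ← Real.sqrt_mul (by positivity)]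
  refine Real.sqrt_le_sqrt ?_
  rw [← integral_const_mul, ← integral_const_mul]
  refine setIntegral_mono_on (integrable_polyWeight hpL F hF).integrableOn
    (hF.const_mul _ |>.const_mul _).integrableOn (measurableSet_band n) fun ξ hξ => ?_
  have := mul_le_mul_of_nonneg_right (polyWeight_le_of_mem_band hpL hh hn hξ) (sq_nonneg ‖F ξ‖)
  linarith

/-- Cauchy–Schwarz between `|n|⁻¹` and the Sobolev norms of the bands. The band `n = 0` offers no
gain and is left out of the estimate; `M` is uniform in `F`, as the passage to scale `T` requires.
-/
theorem summable_bandNorm {p L : ℕ} (hpL : p ≤ L) (hh : 0 < h) : ∃ M : ℝ, 0 ≤ M ∧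
    ∀ F : Lp ℂ 2 (volume : Measure ℝ), Integrable (fun ξ => (ξ ^ 2) ^ (L + 1) * ‖F ξ‖ ^ 2) →
      Summable (bandNorm h p F) ∧ ∑' n : ℤ, (if n = 0 then 0 else bandNorm h p F n) ≤
        M * Real.sqrt (∫ ξ, (ξ ^ 2) ^ (L + 1) * ‖F ξ‖ ^ 2) := by
  set M0 := Real.sqrt (max 1 (4 / h ^ 2) ^ L * (4 / h ^ 2)) with hM0
  refine ⟨M0 * Real.sqrt (∑' n : ℤ, |(n : ℝ)|⁻¹ ^ 2), by positivity, fun F hF => ?_⟩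
  set w : ℤ → ℝ := fun n => Real.sqrt (∫ ξ in band h n, (ξ ^ 2) ^ (L + 1) * ‖F ξ‖ ^ 2) with hw
  have hw2 : HasSum (fun n => w n ^ 2) (∫ ξ, (ξ ^ 2) ^ (L + 1) * ‖F ξ‖ ^ 2) := by
    have := hasSum_setIntegral_band hh hF
    have e : (fun n => w n ^ 2) = fun n => ∫ ξ in band h n, (ξ ^ 2) ^ (L + 1) * ‖F ξ‖ ^ 2 :=
      funext fun n => Real.sq_sqrt (integral_nonneg fun ξ => by positivity)
    rwa [e]
  have hn2 : Summable fun n : ℤ => |(n : ℝ)|⁻¹ ^ 2 := by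
    have := Real.summable_one_div_int_pow.2 (le_refl 2)
    simpa [one_div, inv_pow, sq_abs] using this
  have hmul : Summable fun n : ℤ => |(n : ℝ)|⁻¹ * w n := by
    refine Summable.of_nonneg_of_le (fun n => by positivity) (fun n => ?_)
      (hn2.add hw2.summable)
    nlinarith [sq_nonneg (|(n : ℝ)|⁻¹ - w n), sq_nonneg (|(n : ℝ)|⁻¹), sq_nonneg (w n)]
  have hcs := Real.inner_le_Lp_mul_Lq_tsum_of_nonneg (p := 2) (q := 2)
    Real.HolderConjugate.two_two (f := fun n : ℤ => |(n : ℝ)|⁻¹) (g := w)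
    (fun n => by positivity) (fun n => Real.sqrt_nonneg _)
    (by simpa using hn2) (by simpa using hw2.summable)
  simp only [Real.rpow_two] at hcs
  rw [hw2.tsum_eq, ← Real.sqrt_eq_rpow, ← Real.sqrt_eq_rpow] at hcs
  have hle : ∀ n : ℤ, (if n = 0 then 0 else bandNorm h p F n) ≤ M0 * (|(n : ℝ)|⁻¹ * w n) := by
    intro n
    by_cases hn : n = 0
    · simp [hn]
    · rw [if_neg hn]; exact bandNorm_le hpL hh F hF hn
  have hsum : Summable fun n : ℤ => (if n = 0 then 0 else bandNorm h p F n) := by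
    refine Summable.of_nonneg_of_le (fun n => ?_) hle (hmul.mul_left M0)
    split_ifs
    · exact le_rfl
    · exact Real.sqrt_nonneg _
  constructor
  · refine (hsum.add (summable_of_ne_finset_zero (s := {(0 : ℤ)})
      (f := fun n : ℤ => if n = 0 then bandNorm h p F n else 0) ?_)).congr ?_
    · intro n hn
      rw [if_neg (by simpa using hn)]
    · intro n
      split_ifs <;> simp
  · calc _ ≤ ∑' n : ℤ, M0 * (|(n : ℝ)|⁻¹ * w n) := hsum.tsum_le_tsum hle (hmul.mul_left M0)
      _ = M0 * ∑' n : ℤ, |(n : ℝ)|⁻¹ * w n := tsum_mul_left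
      _ ≤ _ := by rw [mul_assoc]; exact mul_le_mul_of_nonneg_left hcs (by positivity)

end Bands

/-! ### Synthesis operator -/

section Synthesis

variable {ι : Type*} [Fintype ι] {h A B : ℝ} {Φ : ι → ℝ → ℂ}
  {b : ι × ℤ → Lp ℂ 2 (volume : Measure ℝ)}

theorem hasSum_norm_sq_lp {κ : Type*} (x : lp (fun _ : κ => ℂ) 2) :
    HasSum (fun q => ‖x q‖ ^ 2) (‖x‖ ^ 2) := by
  have := lp.hasSum_norm (p := 2) (by norm_num) x
  simpa using this

/-- The synthesis operator `c ↦ ∑ c_q b_q` of a Riesz sequence. -/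
def ModulatedRiesz.synthesis (hR : ModulatedRiesz h Φ b A B) :
    lp (fun _ : ι × ℤ => ℂ) 2 →L[ℂ] Lp ℂ 2 (volume : Measure ℝ) :=
  LinearMap.mkContinuous
    { toFun := fun x => ∑' q, x q • b q
      map_add' := fun x y => by
        rw [← ((hR.riesz x (hasSum_norm_sq_lp x).summable).1).tsum_add
          (hR.riesz y (hasSum_norm_sq_lp y).summable).1]
        exact tsum_congr fun q => by rw [lp.coeFn_add, Pi.add_apply, add_smul]
      map_smul' := fun a x => by
        rw [RingHom.id_apply, ← ((hR.riesz x (hasSum_norm_sq_lp x).summable).1).tsum_const_smul]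
        exact tsum_congr fun q => by rw [lp.coeFn_smul, Pi.smul_apply, smul_assoc] }
    (Real.sqrt B) fun x => by
      have h1 := (hR.riesz x (hasSum_norm_sq_lp x).summable).2.2
      rw [(hasSum_norm_sq_lp x).tsum_eq] at h1
      refine le_of_sq_le_sq ?_ (by positivity)
      rw [mul_pow, Real.sq_sqrt hR.upper_pos.le]
      exact h1

theorem ModulatedRiesz.synthesis_apply (hR : ModulatedRiesz h Φ b A B)
    (x : lp (fun _ : ι × ℤ => ℂ) 2) : hR.synthesis x = ∑' q, x q • b q := rfl

end Synthesis

/-! ### The sampling operator in the Fourier domain -/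

/-- The coefficients `∫ F(ξ) conj(Ψ_i(ξ)) exp(2πi k ξ / h) dξ`. -/
def samplingCoeff {ι : Type*} (h : ℝ) (Ψ : ι → ℝ → ℂ) (F : ℝ → ℂ) (q : ι × ℤ) : ℂ :=
  ∫ ξ, phase (-(q.2 * ξ / h)) * (F ξ * conj (Ψ q.1 ξ))

/-- The error kernel `K` of the sampling functions `Ψ`, of polynomial growth of degree `2p`. -/
structure HasErrorKernel {ι : Type*} [Fintype ι] (h : ℝ) (Φ Ψ : ι → ℝ → ℂ) (K : ℝ → ℝ) (D : ℝ)
    (p : ℕ) : Prop where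
  continuous : ∀ i, Continuous (Ψ i)
  hasSum : ∀ᵐ ξ : ℝ, HasSum (fun n : ℤ =>
    ‖(if n = 0 then 1 else 0) - h * ∑ i, conj (Ψ i ξ) * Φ i (ξ + n * h)‖ ^ 2) (K ξ)
  le : ∀ᵐ ξ : ℝ, K ξ ≤ D * polyWeight p ξ

section Error

variable {ι : Type*} [Fintype ι] {h A B D : ℝ} {Φ Ψ : ι → ℝ → ℂ} {K : ℝ → ℝ} {p L : ℕ}
  {b : ι × ℤ → Lp ℂ 2 (volume : Measure ℝ)} {F : Lp ℂ 2 (volume : Measure ℝ)}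

theorem HasErrorKernel.nonneg (hK : HasErrorKernel h Φ Ψ K D p) : ∀ᵐ ξ : ℝ, 0 ≤ K ξ := by
  filter_upwards [hK.hasSum] with ξ h1 using h1.nonneg fun n => by positivity

theorem HasErrorKernel.aemeasurable (hK : HasErrorKernel h Φ Ψ K D p)
    (hR : ModulatedRiesz h Φ b A B) : AEMeasurable K volume := by
  refine ⟨fun ξ => ∑' n : ℤ,
    ‖(if n = 0 then 1 else 0) - h * ∑ i, conj (Ψ i ξ) * Φ i (ξ + n * h)‖ ^ 2, ?_, ?_⟩
  · refine Measurable.tsum fun n => (Measurable.norm ?_).pow_const _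
    refine measurable_const.sub (Measurable.const_mul ?_ _)
    refine Finset.measurable_fun_sum _ fun i _ => Measurable.mul ?_ ?_
    · exact (Complex.continuous_conj.comp (hK.continuous i)).measurable
    · exact (hR.measurable i).comp (measurable_id.add_const _)
  · filter_upwards [hK.hasSum] with ξ h1 using h1.tsum_eq.symm

/-- `kernel_bound` with the fibrewise frame constant `A / h`; the additive `2` is absorbed because
the weight is at least `1`. -/
theorem HasErrorKernel.sampling_bound (hK : HasErrorKernel h Φ Ψ K D p)
    (hR : ModulatedRiesz h Φ b A B) : ∀ᵐ ξ : ℝ,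
    h * ∑ i, ‖Ψ i ξ‖ ^ 2 ≤ 2 * (1 + D) / A * polyWeight p ξ := by
  filter_upwards [hK.hasSum, hK.le, hR.ae_frame] with ξ h1 h2 h3
  have h4 := kernel_bound (x := fun (n : ℤ) i => Φ i (ξ + n * h)) hR.pos h3.1 h3.2
    (fun i => Ψ i ξ) h1
  have h5 := one_le_polyWeight p ξ
  have hA := hR.lower_pos
  have hh := hR.pos
  rw [div_mul_eq_mul_div, le_div_iff₀ hA]
  have e : h ^ 2 * (A / h * ∑ i, ‖Ψ i ξ‖ ^ 2) = h * (∑ i, ‖Ψ i ξ‖ ^ 2) * A := by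
    field_simp
  linarith

theorem HasErrorKernel.integrable_kernel (hK : HasErrorKernel h Φ Ψ K D p)
    (hR : ModulatedRiesz h Φ b A B) (hpL : p ≤ L)
    (hF : Integrable fun ξ => (ξ ^ 2) ^ (L + 1) * ‖F ξ‖ ^ 2) :
    Integrable fun ξ => ‖F ξ‖ ^ 2 * K ξ := by
  refine ((integrable_polyWeight hpL F hF).const_mul D).mono' ?_ ?_
  · exact ((Lp.aestronglyMeasurable F).norm.pow 2).mul (hK.aemeasurable hR).aestronglyMeasurable
  · filter_upwards [hK.nonneg, hK.le] with ξ h1 h2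
    rw [Real.norm_of_nonneg (by positivity)]
    have := mul_le_mul_of_nonneg_left h2 (sq_nonneg ‖F ξ‖)
    linarith

theorem HasErrorKernel.sampling_single (hK : HasErrorKernel h Φ Ψ K D p)
    (hR : ModulatedRiesz h Φ b A B) (i : ι) : ∀ᵐ ξ : ℝ,
    ‖Ψ i ξ‖ ^ 2 ≤ 2 * (1 + D) / A / h * polyWeight p ξ := by
  filter_upwards [hK.sampling_bound hR] with ξ h1
  have h2 := Finset.single_le_sum (f := fun i => ‖Ψ i ξ‖ ^ 2) (fun i _ => sq_nonneg _)
    (Finset.mem_univ i)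
  have hh := hR.pos
  rw [div_mul_eq_mul_div, le_div_iff₀ hh]
  nlinarith

theorem HasErrorKernel.integrable_mul_conj (hK : HasErrorKernel h Φ Ψ K D p)
    (hR : ModulatedRiesz h Φ b A B) (hpL : p ≤ L)
    (hF : Integrable fun ξ => (ξ ^ 2) ^ (L + 1) * ‖F ξ‖ ^ 2) (i : ι) :
    Integrable fun ξ => F ξ * conj (Ψ i ξ) := by
  have h1 := (integrable_polyWeight_mul hpL F hF).const_mul (2 * (1 + D) / A / h)
  refine (h1.add integrable_inv_one_add_sq).mono' ?_ ?_
  · exact (Lp.aestronglyMeasurable F).mul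
      (Complex.continuous_conj.comp (hK.continuous i)).aestronglyMeasurable
  · filter_upwards [hK.sampling_single hR i] with ξ h2
    rw [norm_mul, RCLike.norm_conj, Pi.add_apply]
    have ht : 0 < 1 + ξ ^ 2 := by positivity
    have h3 := mul_le_mul_of_nonneg_right h2
      (show 0 ≤ (1 + ξ ^ 2) * ‖F ξ‖ ^ 2 by positivity)
    -- The inequality `x ≤ s x² + s⁻¹` with `s = 1 + ξ²`: the first term is controlled by the
    -- Sobolev weight, the second is integrable.
    have h4 : ‖F ξ‖ * ‖Ψ i ξ‖ ≤ ‖Ψ i ξ‖ ^ 2 * ((1 + ξ ^ 2) * ‖F ξ‖ ^ 2) + (1 + ξ ^ 2)⁻¹ := by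
      generalize 1 + ξ ^ 2 = s at ht
      have h5 : s * (‖F ξ‖ * ‖Ψ i ξ‖) ≤ s * (‖Ψ i ξ‖ ^ 2 * (s * ‖F ξ‖ ^ 2) + s⁻¹) := by
        rw [mul_add, mul_inv_cancel₀ ht.ne']
        nlinarith [sq_nonneg (s * (‖F ξ‖ * ‖Ψ i ξ‖) - 1), sq_nonneg (s * (‖F ξ‖ * ‖Ψ i ξ‖))]
      exact le_of_mul_le_mul_left h5 ht
    refine h4.trans ?_
    linarith

/-- The `h`-periodization data of a band. -/
def bandData (h : ℝ) (Ψ : ι → ℝ → ℂ) (F : ℝ → ℂ) (i : ι) (ξ : ℝ) : ℂ := h * (F ξ * conj (Ψ i ξ))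

theorem exists_polyWeight_le_on_band (h : ℝ) (p : ℕ) (n : ℤ) :
    ∃ M, ∀ ξ ∈ band h n, polyWeight p ξ ≤ M := by
  obtain ⟨M, hM⟩ :=
    (isCompact_Icc (a := bandStart h n) (b := bandStart h n + h)).exists_bound_of_continuousOn
      (continuous_polyWeight p).continuousOn
  exact ⟨M, fun ξ hξ => (le_abs_self _).trans (hM ξ (Set.Ioc_subset_Icc_self hξ))⟩

theorem HasErrorKernel.memLp_bandData (hK : HasErrorKernel h Φ Ψ K D p)
    (hR : ModulatedRiesz h Φ b A B) (hD : 0 ≤ D) (n : ℤ) (i : ι) :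
    MemLp (bandData h Ψ F i) 2
      (volume.restrict (Set.Ioc (bandStart h n) (bandStart h n + h))) := by
  obtain ⟨M, hM⟩ := exists_polyWeight_le_on_band h p n
  have hA := hR.lower_pos
  have hh := hR.pos
  refine ((Lp.memLp F).restrict _).of_le_mul (c := h * Real.sqrt (2 * (1 + D) / A / h * M)) ?_ ?_
  · exact ((Lp.aestronglyMeasurable F).mul
      (Complex.continuous_conj.comp (hK.continuous i)).aestronglyMeasurable).const_mul _ |>.restrict
  · filter_upwards [ae_restrict_of_ae (hK.sampling_single hR i),
      ae_restrict_mem (measurableSet_band (h := h) n)] with ξ h1 h2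
    rw [bandData, norm_mul, norm_mul, RCLike.norm_conj, Complex.norm_real,
      Real.norm_of_nonneg hh.le, mul_assoc, mul_comm ‖F ξ‖]
    have h3 : ‖Ψ i ξ‖ ≤ Real.sqrt (2 * (1 + D) / A / h * M) := by
      refine Real.le_sqrt_of_sq_le (h1.trans ?_)
      have := hM ξ h2
      gcongr
    gcongr

omit [Fintype ι] in
theorem bandCoeff_bandData (hh : 0 < h) (F : ℝ → ℂ) (n : ℤ) (q : ι × ℤ) :
    bandCoeff h (bandStart h n) (bandData h Ψ F) q =
      ∫ ξ in band h n, phase (-(q.2 * ξ / h)) * (F ξ * conj (Ψ q.1 ξ)) := by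
  rw [bandCoeff, intervalIntegral.integral_of_le (by linarith), ← integral_smul]
  refine integral_congr_ae (Eventually.of_forall fun ξ => ?_)
  simp only [bandData, Complex.real_smul]
  have : (h : ℂ) ≠ 0 := by exact_mod_cast hh.ne'
  push_cast
  field_simp

/-- The sequence of the coefficients of a band, as an element of `ℓ²`. -/
def HasErrorKernel.bandSeq (hK : HasErrorKernel h Φ Ψ K D p) (hR : ModulatedRiesz h Φ b A B)
    (hD : 0 ≤ D) (F : Lp ℂ 2 (volume : Measure ℝ)) (n : ℤ) : lp (fun _ : ι × ℤ => ℂ) 2 :=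
  ⟨bandCoeff h (bandStart h n) (bandData h Ψ F), by
    refine memℓp_gen ?_
    simpa using (hasSum_norm_sq_bandCoeff hR.pos (bandStart h n) (bandData h Ψ F)
      (hK.memLp_bandData hR hD n)).summable⟩

/-- Parseval on the band, followed by `sampling_bound` under the integral. -/
theorem HasErrorKernel.norm_bandSeq_le (hK : HasErrorKernel h Φ Ψ K D p)
    (hR : ModulatedRiesz h Φ b A B) (hD : 0 ≤ D) (hpL : p ≤ L)
    (hF : Integrable fun ξ => (ξ ^ 2) ^ (L + 1) * ‖F ξ‖ ^ 2) (n : ℤ) :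
    ‖hK.bandSeq hR hD F n‖ ≤ Real.sqrt (2 * (1 + D) / A) * bandNorm h p F n := by
  have hh := hR.pos
  have hA := hR.lower_pos
  rw [bandNorm, ← Real.sqrt_mul (by positivity)]
  refine Real.le_sqrt_of_sq_le ?_
  have h1 := hasSum_norm_sq_bandCoeff hh (bandStart h n) (bandData h Ψ F)
    (hK.memLp_bandData hR hD n)
  rw [(hasSum_norm_sq_lp (hK.bandSeq hR hD F n)).unique h1, ← integral_const_mul]
  have hint : ∀ i, IntegrableOn (fun x => ‖bandData h Ψ F i x‖ ^ 2) (band h n) := fun i =>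
    (memLp_two_iff_integrable_sq_norm (hK.memLp_bandData hR hD n i).1).1
      (hK.memLp_bandData hR hD n i)
  simp_rw [intervalIntegral.integral_of_le (show bandStart h n ≤ bandStart h n + h by linarith)]
  change h⁻¹ * ∑ i, ∫ x in band h n, ‖bandData h Ψ F i x‖ ^ 2 ≤ _
  rw [← integral_finsetSum _ fun i _ => hint i, ← integral_const_mul]
  refine integral_mono_ae ((integrable_finsetSum _ fun i _ => hint i).const_mul _)
    ((integrable_polyWeight hpL F hF).const_mul _).integrableOn ?_
  filter_upwards [ae_restrict_of_ae (hK.sampling_bound hR)] with ξ h2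
  have e : h⁻¹ * ∑ i, ‖bandData h Ψ F i ξ‖ ^ 2 = ‖F ξ‖ ^ 2 * (h * ∑ i, ‖Ψ i ξ‖ ^ 2) := by
    simp_rw [bandData, norm_mul, RCLike.norm_conj, Complex.norm_real, mul_pow, Real.norm_eq_abs,
      sq_abs, ← Finset.mul_sum]
    field_simp
  rw [e]
  have := mul_le_mul_of_nonneg_left h2 (sq_nonneg ‖F ξ‖)
  linarith

/-- The exact error formula for functions supported in a band. -/
theorem HasErrorKernel.norm_sq_band_error (hK : HasErrorKernel h Φ Ψ K D p)
    (hR : ModulatedRiesz h Φ b A B) (hD : 0 ≤ D) (hpL : p ≤ L)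
    (hF : Integrable fun ξ => (ξ ^ 2) ^ (L + 1) * ‖F ξ‖ ^ 2) (n : ℤ) :
    ‖bandPart h F n - hR.synthesis (hK.bandSeq hR hD F n)‖ ^ 2 =
      ∫ ξ in band h n, ‖F ξ‖ ^ 2 * K ξ := by
  have hh := hR.pos
  have h1 := hR.enorm_sub_sq (bandStart h n) (bandData h Ψ F) (hK.memLp_bandData hR hD n)
    (bandPart h F n)
  have h2 : ∫⁻ ξ in Set.Ioc (bandStart h n) (bandStart h n + h), ∑' m : ℤ,
      ‖bandPart h F n (ξ + m * h) - ∑ i, bandData h Ψ F i ξ * Φ i (ξ + m * h)‖ₑ ^ 2 =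
      ∫⁻ ξ in band h n, ENNReal.ofReal (‖F ξ‖ ^ 2 * K ξ) := by
    refine lintegral_congr_ae ?_
    filter_upwards [ae_restrict_of_ae (ae_shift (bandPart_ae (h := h) F n) h),
      ae_restrict_of_ae hK.hasSum, ae_restrict_mem (measurableSet_band (h := h) n)] with ξ k1 k2 k3
    -- Over a point `ξ` of the band, the fibre of the band part is `δ_m F(ξ)`, so `|F(ξ)|²` factors
    -- out and the series of the kernel remains.
    have k4 : ∀ m : ℤ, ‖bandPart h F n (ξ + m * h) -
        ∑ i, bandData h Ψ F i ξ * Φ i (ξ + m * h)‖ₑ ^ 2 = ENNReal.ofReal (‖F ξ‖ ^ 2 *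
        ‖(if m = 0 then 1 else 0) - h * ∑ i, conj (Ψ i ξ) * Φ i (ξ + m * h)‖ ^ 2) := by
      intro m
      rw [← ofReal_norm_sq, ← mul_pow, ← norm_mul, k1 m]
      congr 3
      rw [mul_sub, Finset.mul_sum, Finset.mul_sum]
      congr 1
      · by_cases hm : m = 0
        · have k3' : ξ ∈ band h n := k3
          simp [hm, k3']
        · rw [Set.indicator_of_notMem fun hc => hm ((add_mem_band_iff hh k3).1 hc), if_neg hm,
            mul_zero]
      · exact Finset.sum_congr rfl fun i _ => by rw [bandData]; ring
    simp_rw [k4]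
    have k5 := k2.mul_left (‖F ξ‖ ^ 2)
    rw [← ENNReal.ofReal_tsum_of_nonneg (fun m => by positivity) k5.summable, k5.tsum_eq]
  rw [h2, ← ofReal_integral_eq_lintegral_ofReal (hK.integrable_kernel hR hpL hF).integrableOn
    (ae_restrict_of_ae (hK.nonneg.mono fun ξ hξ => by positivity)), ← ofReal_norm_sq] at h1
  exact (ENNReal.ofReal_eq_ofReal_iff (by positivity) (integral_nonneg_of_ae
    (ae_restrict_of_ae (hK.nonneg.mono fun ξ hξ => by positivity)))).1 h1

theorem HasErrorKernel.band_error_le (hK : HasErrorKernel h Φ Ψ K D p)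
    (hR : ModulatedRiesz h Φ b A B) (hD : 0 ≤ D) (hpL : p ≤ L)
    (hF : Integrable fun ξ => (ξ ^ 2) ^ (L + 1) * ‖F ξ‖ ^ 2) (n : ℤ) :
    ‖bandPart h F n - hR.synthesis (hK.bandSeq hR hD F n)‖ ≤
      Real.sqrt D * bandNorm h p F n := by
  rw [bandNorm, ← Real.sqrt_mul hD]
  refine Real.le_sqrt_of_sq_le ?_
  rw [hK.norm_sq_band_error hR hD hpL hF n, ← integral_const_mul]
  refine integral_mono_ae (hK.integrable_kernel hR hpL hF).integrableOn
    ((integrable_polyWeight hpL F hF).const_mul _).integrableOn ?_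
  filter_upwards [ae_restrict_of_ae hK.le] with ξ h2
  have := mul_le_mul_of_nonneg_left h2 (sq_nonneg ‖F ξ‖)
  linarith

theorem norm_bandPart_le (hpL : p ≤ L)
    (hF : Integrable fun ξ => (ξ ^ 2) ^ (L + 1) * ‖F ξ‖ ^ 2) (n : ℤ) :
    ‖bandPart h F n‖ ≤ bandNorm h p F n := by
  refine Real.le_sqrt_of_sq_le ?_
  rw [norm_sq_bandPart]
  refine integral_mono (integrable_norm_sq F).integrableOn
    (integrable_polyWeight hpL F hF).integrableOn fun ξ => ?_
  have h1 := one_le_polyWeight p ξ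
  have := mul_le_mul_of_nonneg_right h1 (sq_nonneg ‖F ξ‖)
  simpa using this

/-- The band sequences sum absolutely in `ℓ²`, and each coordinate of the sum is the integral over
the whole line. Hence the full coefficient sequence lies in `ℓ²`. -/
theorem HasErrorKernel.exists_seq (hK : HasErrorKernel h Φ Ψ K D p)
    (hR : ModulatedRiesz h Φ b A B) (hD : 0 ≤ D) (hpL : p ≤ L)
    (hF : Integrable fun ξ => (ξ ^ 2) ^ (L + 1) * ‖F ξ‖ ^ 2)
    (hs : Summable (bandNorm h p F)) :
    ∃ x : lp (fun _ : ι × ℤ => ℂ) 2, (∀ q, x q = samplingCoeff h Ψ F q) ∧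
      HasSum (hK.bandSeq hR hD F) x := by
  have h1 : Summable (hK.bandSeq hR hD F) :=
    Summable.of_norm_bounded (hs.mul_left _) (hK.norm_bandSeq_le hR hD hpL hF)
  refine ⟨∑' n, hK.bandSeq hR hD F n, fun q => ?_, h1.hasSum⟩
  have h2 := h1.hasSum.mapL (lp.evalCLM ℂ (fun _ : ι × ℤ => ℂ) 2 q)
  have h3 : Integrable fun ξ => phase (-(q.2 * ξ / h)) * (F ξ * conj (Ψ q.1 ξ)) := by
    refine (hK.integrable_mul_conj hR hpL hF q.1).bdd_mul (c := 1)
      (continuous_phase.comp (by fun_prop)).aestronglyMeasurable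
      (Eventually.of_forall fun ξ => (norm_phase _).le)
  have h4 := hasSum_setIntegral_band hR.pos h3
  rw [← funext fun n => bandCoeff_bandData hR.pos F n q] at h4
  exact h2.unique h4

theorem tsum_sq_le_sq_tsum {e : ℤ → ℝ} (he : ∀ n, 0 ≤ e n) (hs : Summable e) {E : ℝ}
    (hE : HasSum (fun n => e n ^ 2) E) : E ≤ (∑' n, e n) ^ 2 := by
  rw [sq]
  refine hasSum_le (fun n => ?_) hE (hs.hasSum.mul_left (∑' n, e n))
  rw [sq]
  exact mul_le_mul_of_nonneg_right (hs.le_tsum n fun m _ => he m) (he n)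

/-- The estimate at scale one. Both the true and the predicted error are compared with the error `‖d
0‖` of the central band, at a cost of one tail `R` each; this is the factor `2` in the constant. -/
theorem HasErrorKernel.error_estimate (hK : HasErrorKernel h Φ Ψ K D p)
    (hR : ModulatedRiesz h Φ b A B) (hD : 0 ≤ D) (hpL : p ≤ L) : ∃ M : ℝ,
    ∀ F : Lp ℂ 2 (volume : Measure ℝ), Integrable (fun ξ => (ξ ^ 2) ^ (L + 1) * ‖F ξ‖ ^ 2) →
      Summable (fun q => samplingCoeff h Ψ F q • b q) ∧
      |‖F - ∑' q, samplingCoeff h Ψ F q • b q‖ - Real.sqrt (∫ ξ, ‖F ξ‖ ^ 2 * K ξ)| ≤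
        M * Real.sqrt (∫ ξ, (ξ ^ 2) ^ (L + 1) * ‖F ξ‖ ^ 2) := by
  obtain ⟨M, hM0, hM⟩ := summable_bandNorm (p := p) hpL hR.pos
  refine ⟨2 * (Real.sqrt D * M), fun F hF => ?_⟩
  obtain ⟨hs, hs2⟩ := hM F hF
  obtain ⟨x, hx, hxs⟩ := hK.exists_seq hR hD hpL hF hs
  have hsum : Summable (fun q => samplingCoeff h Ψ F q • b q) := by
    simpa only [hx] using (hR.riesz x (hasSum_norm_sq_lp x).summable).1
  refine ⟨hsum, ?_⟩
  have hS : ∑' q, samplingCoeff h Ψ F q • b q = hR.synthesis x := by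
    rw [hR.synthesis_apply]; simp only [hx]
  have hFs : HasSum (bandPart h F) F := hasSum_bandPart hR.pos F
    (Summable.of_nonneg_of_le (fun _ => norm_nonneg _) (norm_bandPart_le hpL hF) hs)
  set d : ℤ → Lp ℂ 2 (volume : Measure ℝ) := fun n =>
    bandPart h F n - hR.synthesis (hK.bandSeq hR hD F n) with hd
  have hds : HasSum d (F - hR.synthesis x) := hFs.sub (hxs.mapL hR.synthesis)
  have hdn : ∀ n, ‖d n‖ ≤ Real.sqrt D * bandNorm h p F n := hK.band_error_le hR hD hpL hF
  have hdsum : Summable fun n => ‖d n‖ :=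
    Summable.of_nonneg_of_le (fun _ => norm_nonneg _) hdn (hs.mul_left _)
  have hE : HasSum (fun n => ‖d n‖ ^ 2) (∫ ξ, ‖F ξ‖ ^ 2 * K ξ) := by
    have := hasSum_setIntegral_band hR.pos (hK.integrable_kernel hR hpL hF)
    simpa only [hd, hK.norm_sq_band_error hR hD hpL hF] using this
  have hite : Summable fun n : ℤ => if n = 0 then 0 else ‖d n‖ := by
    refine Summable.of_nonneg_of_le (fun n => ?_) (fun n => ?_) hdsum
    · split_ifs <;> positivity
    · split_ifs
      · positivity
      · exact le_rfl
  have hbite : Summable fun n : ℤ => if n = 0 then 0 else bandNorm h p F n := by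
    refine Summable.of_nonneg_of_le (fun n => ?_) (fun n => ?_) hs
    · split_ifs
      · exact le_rfl
      · exact Real.sqrt_nonneg _
    · split_ifs
      · exact Real.sqrt_nonneg _
      · exact le_rfl
  set R := ∑' n : ℤ, if n = 0 then 0 else ‖d n‖ with hRdef
  have hR1 : R ≤ Real.sqrt D * M * Real.sqrt (∫ ξ, (ξ ^ 2) ^ (L + 1) * ‖F ξ‖ ^ 2) := by
    calc R ≤ ∑' n : ℤ, Real.sqrt D * (if n = 0 then 0 else bandNorm h p F n) := by
          refine hite.tsum_le_tsum (fun n => ?_) (hbite.mul_left _)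
          split_ifs
          · simp
          · exact hdn n
      _ = Real.sqrt D * ∑' n : ℤ, (if n = 0 then 0 else bandNorm h p F n) := tsum_mul_left
      _ ≤ _ := by rw [mul_assoc]; exact mul_le_mul_of_nonneg_left hs2 (Real.sqrt_nonneg _)
  have htot : ∑' n, ‖d n‖ = ‖d 0‖ + R := hdsum.tsum_eq_add_tsum_ite 0
  have hrest : ‖(F - hR.synthesis x) - d 0‖ ≤ R := by
    have h1 := hds.summable.tsum_eq_add_tsum_ite 0
    rw [hds.tsum_eq] at h1
    rw [h1, add_sub_cancel_left]
    have e : ∀ n : ℤ, ‖if n = 0 then 0 else d n‖ = if n = 0 then 0 else ‖d n‖ := by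
      intro n; split_ifs <;> simp
    have h2 : Summable fun n : ℤ => ‖if n = 0 then 0 else d n‖ := by simpa only [e] using hite
    refine (norm_tsum_le_tsum_norm h2).trans ?_
    simp only [e]; exact le_rfl
  have h0 : |‖F - hR.synthesis x‖ - ‖d 0‖| ≤ R := (abs_norm_sub_norm_le _ _).trans hrest
  have hlow : ‖d 0‖ ≤ Real.sqrt (∫ ξ, ‖F ξ‖ ^ 2 * K ξ) :=
    Real.le_sqrt_of_sq_le (le_hasSum hE 0 fun n _ => by positivity)
  -- The `ℓ²` norm of the band errors is at most their `ℓ¹` norm.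
  have hup : Real.sqrt (∫ ξ, ‖F ξ‖ ^ 2 * K ξ) ≤ ‖d 0‖ + R := by
    rw [← htot]
    exact Real.sqrt_le_iff.2 ⟨tsum_nonneg fun _ => norm_nonneg _,
      tsum_sq_le_sq_tsum (fun _ => norm_nonneg _) hdsum hE⟩
  rw [hS]
  have h3 := abs_le.1 h0
  rw [abs_le]
  constructor <;> nlinarith [h3.1, h3.2]

end Error

/-! ### Sobolev functions -/

/-- Membership gives some `g` in `L²` equal to `(1 + ξ²)^((L+1)/2) F` as a distribution; test
functions of compact support make this an equality almost everywhere, and `ξ² ≤ 1 + ξ²`. -/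
theorem integrable_of_memSobolev {L : ℕ} {f : Lp ℂ 2 (volume : Measure ℝ)}
    (hf : TemperedDistribution.MemSobolev ((L : ℝ) + 1) 2 (f : 𝓢'(ℝ, ℂ))) :
    Integrable fun ξ => (ξ ^ 2) ^ (L + 1) * ‖(𝓕 f : Lp ℂ 2 (volume : Measure ℝ)) ξ‖ ^ 2 := by
  obtain ⟨g, hg⟩ := TemperedDistribution.memSobolev_iff_exists_smulLeftCLM_fourier.1 hf
  rw [Lp.fourier_toTemperedDistribution_eq] at hg
  set F : Lp ℂ 2 (volume : Measure ℝ) := 𝓕 f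
  set w : ℝ → ℂ := fun x => (((1 + ‖x‖ ^ 2) ^ (((L : ℝ) + 1) / 2) : ℝ) : ℂ) with hw
  have hwt : w.HasTemperateGrowth := by fun_prop
  have hae : ∀ᵐ ξ : ℝ, w ξ • F ξ = g ξ := by
    refine ae_eq_of_integral_contDiff_smul_eq ?_ ((Lp.memLp g).locallyIntegrable (by norm_num)) ?_
    · exact ((Lp.memLp F).locallyIntegrable (by norm_num)).continuous_smul hwt.1.continuous
    · intro η η_smooth η_cpt
      have hg₁ : HasCompactSupport (Complex.ofRealCLM ∘ η) := η_cpt.comp_left rfl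
      have hg₂ : ContDiff ℝ (⊤ : ℕ∞) (Complex.ofRealCLM ∘ η) := by fun_prop
      have := congrArg (fun v : 𝓢'(ℝ, ℂ) => v (hg₁.toSchwartzMap hg₂)) hg
      simp only [TemperedDistribution.smulLeftCLM_apply_apply, Lp.toTemperedDistribution_apply,
        SchwartzMap.smulLeftCLM_apply_apply hwt] at this
      have e1 : ∫ x, η x • (w x • F x) =
          ∫ x, (w x • (hg₁.toSchwartzMap hg₂) x) • F x :=
        integral_congr_ae (Eventually.of_forall fun ξ => by simp; ring)
      rw [e1, this]
      exact integral_congr_ae (Eventually.of_forall fun ξ => by simp)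
  have hw2 : ∀ ξ, ‖w ξ‖ ^ 2 = (1 + ξ ^ 2) ^ (L + 1) := by
    intro ξ
    rw [hw, Complex.norm_real, Real.norm_of_nonneg (by positivity), Real.norm_eq_abs, sq_abs,
      ← Real.rpow_mul_natCast (by positivity), ← Real.rpow_natCast (1 + ξ ^ 2) (L + 1)]
    congr 1
    push_cast; ring
  refine (integrable_norm_sq g).mono' ?_ ?_
  · exact (by fun_prop : Continuous fun ξ : ℝ => (ξ ^ 2) ^ (L + 1)).aestronglyMeasurable.mul
      ((Lp.aestronglyMeasurable F).norm.pow 2)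
  · filter_upwards [hae] with ξ hξ
    rw [Real.norm_of_nonneg (by positivity), ← hξ, norm_smul, mul_pow]
    rw [hw2]
    gcongr
    linarith

/-! ### Dilations in the Fourier domain -/

theorem memLp_dilation {T : ℝ} (hT : 0 < T) (G : Lp ℂ 2 (volume : Measure ℝ)) :
    MemLp (fun ξ => (T : ℂ) * G (T * ξ)) 2 volume :=
  (MemLp.comp_mul_left (Lp.memLp G) hT).const_mul _

/-- The dilation `G ↦ T G(T ·)` of `L²`. -/
def dilation {T : ℝ} (hT : 0 < T) :
    Lp ℂ 2 (volume : Measure ℝ) →ₗ[ℂ] Lp ℂ 2 (volume : Measure ℝ) where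
  toFun G := (memLp_dilation hT G).toLp _
  map_add' G H := by
    refine Lp.ext ?_
    filter_upwards [(memLp_dilation hT (G + H)).coeFn_toLp, (memLp_dilation hT G).coeFn_toLp,
      (memLp_dilation hT H).coeFn_toLp, Lp.coeFn_add ((memLp_dilation hT G).toLp _)
        ((memLp_dilation hT H).toLp _),
      (quasiMeasurePreserving_mul_left hT).ae (Lp.coeFn_add G H)] with ξ h1 h2 h3 h4 h5
    rw [h1, h4, Pi.add_apply, h2, h3, h5, Pi.add_apply, mul_add]
  map_smul' a G := by
    refine Lp.ext ?_
    filter_upwards [(memLp_dilation hT (a • G)).coeFn_toLp, (memLp_dilation hT G).coeFn_toLp,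
      Lp.coeFn_smul a ((memLp_dilation hT G).toLp _),
      (quasiMeasurePreserving_mul_left hT).ae (Lp.coeFn_smul a G)] with ξ h1 h2 h3 h4
    rw [h1, RingHom.id_apply, h3, Pi.smul_apply, h2, h4, Pi.smul_apply, smul_eq_mul, smul_eq_mul]
    ring

theorem dilation_ae {T : ℝ} (hT : 0 < T) (G : Lp ℂ 2 (volume : Measure ℝ)) :
    dilation hT G =ᵐ[volume] fun ξ => (T : ℂ) * G (T * ξ) :=
  (memLp_dilation hT G).coeFn_toLp

theorem integral_comp_mul_left_pos {T : ℝ} (hT : 0 < T) {E : Type*} [NormedAddCommGroup E]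
    [NormedSpace ℝ E] (g : ℝ → E) : ∫ x, g (T * x) = T⁻¹ • ∫ y, g y := by
  rw [Measure.integral_comp_mul_left, abs_of_pos (inv_pos.2 hT)]

theorem norm_dilation {T : ℝ} (hT : 0 < T) (G : Lp ℂ 2 (volume : Measure ℝ)) :
    ‖dilation hT G‖ = Real.sqrt T * ‖G‖ := by
  rw [← abs_of_nonneg (norm_nonneg (dilation hT G)),
    ← abs_of_nonneg (show 0 ≤ Real.sqrt T * ‖G‖ by positivity), ← sq_eq_sq_iff_abs_eq_abs, mul_pow,
    Real.sq_sqrt hT.le, norm_sq_eq_integral, norm_sq_eq_integral]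
  have h1 : ∫ ξ, ‖dilation hT G ξ‖ ^ 2 = ∫ ξ, T ^ 2 * ‖G (T * ξ)‖ ^ 2 := by
    refine integral_congr_ae ((dilation_ae hT G).mono fun ξ hξ => ?_)
    simp only [hξ, norm_mul, mul_pow, Complex.norm_real, Real.norm_eq_abs, sq_abs]
  rw [h1, integral_const_mul, integral_comp_mul_left_pos hT fun ξ => ‖G ξ‖ ^ 2, smul_eq_mul]
  field_simp

/-- The dilation `G ↦ T G(T ·)` of `L²` as a continuous operator. -/
def dilationCLM {T : ℝ} (hT : 0 < T) :
    Lp ℂ 2 (volume : Measure ℝ) →L[ℂ] Lp ℂ 2 (volume : Measure ℝ) :=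
  (dilation hT).mkContinuous (Real.sqrt T) fun G => (norm_dilation hT G).le

theorem dilation_dilation_inv {T : ℝ} (hT : 0 < T) (G : Lp ℂ 2 (volume : Measure ℝ)) :
    dilation hT (dilation (inv_pos.2 hT) G) = G := by
  refine Lp.ext ?_
  filter_upwards [dilation_ae hT (dilation (inv_pos.2 hT) G),
    (quasiMeasurePreserving_mul_left hT).ae (dilation_ae (inv_pos.2 hT) G)] with ξ h1 h2
  have : (T : ℂ) ≠ 0 := by exact_mod_cast hT.ne'
  rw [h1, h2, inv_mul_cancel_left₀ hT.ne', Complex.ofReal_inv, mul_inv_cancel_left₀ this]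

/-- Moves the scale from the function to the weight: it serves both for the kernel at `T ω` and for
the Sobolev weight. -/
theorem weighted_integral_dilation_inv {T : ℝ} (hT : 0 < T) (F : Lp ℂ 2 (volume : Measure ℝ))
    (w : ℝ → ℝ) : ∫ ξ, ‖dilation (inv_pos.2 hT) F ξ‖ ^ 2 * w ξ =
      T⁻¹ * ∫ ξ, ‖F ξ‖ ^ 2 * w (T * ξ) := by
  have h1 : ∫ ξ, ‖dilation (inv_pos.2 hT) F ξ‖ ^ 2 * w ξ =
      ∫ ξ, (T⁻¹) ^ 2 * (‖F (T⁻¹ * ξ)‖ ^ 2 * w (T * (T⁻¹ * ξ))) := by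
    refine integral_congr_ae ((dilation_ae (inv_pos.2 hT) F).mono fun ξ hξ => ?_)
    simp only [hξ, norm_mul, mul_pow, Complex.norm_real, Real.norm_eq_abs, sq_abs,
      mul_inv_cancel_left₀ hT.ne', mul_assoc]
  rw [h1, integral_const_mul, integral_comp_mul_left_pos (inv_pos.2 hT)
    fun ξ => ‖F ξ‖ ^ 2 * w (T * ξ), smul_eq_mul]
  field_simp

theorem weighted_integrable_dilation_inv {T : ℝ} (hT : 0 < T) (F : Lp ℂ 2 (volume : Measure ℝ))
    (w : ℝ → ℝ) : Integrable (fun ξ => ‖dilation (inv_pos.2 hT) F ξ‖ ^ 2 * w ξ) ↔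
      Integrable fun ξ => ‖F ξ‖ ^ 2 * w (T * ξ) := by
  have h1 : Integrable (fun ξ => ‖dilation (inv_pos.2 hT) F ξ‖ ^ 2 * w ξ) ↔
      Integrable fun ξ => (T⁻¹) ^ 2 * (‖F (T⁻¹ * ξ)‖ ^ 2 * w (T * (T⁻¹ * ξ))) := by
    refine integrable_congr ((dilation_ae (inv_pos.2 hT) F).mono fun ξ hξ => ?_)
    simp only [hξ, norm_mul, mul_pow, Complex.norm_real, Real.norm_eq_abs, sq_abs,
      mul_inv_cancel_left₀ hT.ne', mul_assoc]
  rw [h1, integrable_const_mul_iff (isUnit_iff_ne_zero.2 (by positivity))]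
  exact integrable_comp_mul_left_iff (fun ξ => ‖F ξ‖ ^ 2 * w (T * ξ)) (inv_ne_zero hT.ne')

/-! ### The approximation scheme in the Fourier domain -/

section Scheme

variable {N : ℕ} {φ : Fin N → ℝ → ℂ} {ψ : Fin N → 𝓢'(ℝ, ℂ)}

/-- The Fourier transforms of the basis functions in the variable `ξ = ω / 2π`. -/
def basisFourier (φ : Fin N → ℝ → ℂ) (i : Fin N) (ξ : ℝ) : ℂ :=
  (𝓕 (toL2 (φ i)) : Lp ℂ 2 (volume : Measure ℝ)) ξ

/-- The Fourier transforms of the sampling functions in the variable `ξ = ω / 2π`. -/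
def samplingFourier (ψ : Fin N → 𝓢'(ℝ, ℂ)) (i : Fin N) (ξ : ℝ) : ℂ :=
  fourierDist (ψ i) (2 * Real.pi * ξ)

theorem fourier_atom (hφ : ∀ i, MemLp (φ i) 2 volume) {T : ℝ} (hT : 0 < T) (q : Fin N × ℤ) :
    (𝓕 (atom φ T q) : Lp ℂ 2 (volume : Measure ℝ)) =ᵐ[volume] fun ξ =>
      T * (phase (T * (N * q.2) * ξ) * basisFourier φ q.1 (T * ξ)) := by
  have : atom φ T q = toL2 (fun t => toL2 (φ q.1) (t / T - N * q.2)) :=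
    toL2_congr ((quasiMeasurePreserving_div_sub hT _).ae ((toL2_coeFn (hφ q.1)).symm))
  rw [this]
  exact fourier_toL2_div_sub _ hT _

/-- The dependence of all atoms on `T` is one common dilation, so the Riesz property is needed only
at scale one. -/
theorem fourier_atom_eq_dilation (hφ : ∀ i, MemLp (φ i) 2 volume) {T : ℝ} (hT : 0 < T)
    (q : Fin N × ℤ) : 𝓕 (atom φ T q) = dilation hT (𝓕 (atom φ 1 q)) := by
  refine Lp.ext ?_
  filter_upwards [fourier_atom hφ hT q, dilation_ae hT (𝓕 (atom φ 1 q)),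
    (quasiMeasurePreserving_mul_left hT).ae (fourier_atom hφ one_pos q)] with ξ h1 h2 h3
  rw [h1, h2, h3, Complex.ofReal_one, one_mul, one_mul, one_mul,
    show T * (N * q.2) * ξ = N * q.2 * (T * ξ) by ring]

theorem hasSum_fourier {κ : Type*} {g : κ → Lp ℂ 2 (volume : Measure ℝ)}
    {s : Lp ℂ 2 (volume : Measure ℝ)} (hg : HasSum g s) : HasSum (fun q => 𝓕 (g q)) (𝓕 s) :=
  hg.mapL (Lp.fourierTransformₗᵢ ℝ ℂ).toContinuousLinearEquiv.toContinuousLinearMap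

theorem summable_of_fourier {κ : Type*} {g : κ → Lp ℂ 2 (volume : Measure ℝ)}
    (hg : Summable fun q => (𝓕 (g q) : Lp ℂ 2 (volume : Measure ℝ))) : Summable g := by
  have := hg.mapL (Lp.fourierTransformₗᵢ ℝ ℂ).symm.toContinuousLinearEquiv.toContinuousLinearMap
  convert this using 2 with q
  exact ((Lp.fourierTransformₗᵢ ℝ ℂ).symm_apply_apply (g q)).symm

theorem IsRiesz.modulatedRiesz (hN : 1 ≤ N) (hφ : ∀ i, MemLp (φ i) 2 volume) (hRiesz : IsRiesz φ) :
    ∃ A B : ℝ, ModulatedRiesz (1 / N : ℝ) (basisFourier φ) (fun q => 𝓕 (atom φ 1 q)) A B := by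
  obtain ⟨A, B, hA, hAB, H⟩ := hRiesz
  have hN0 : (0 : ℝ) < N := by exact_mod_cast hN
  refine ⟨A, B, by positivity, fun _ => (Lp.stronglyMeasurable _).measurable, fun q => ?_, hA,
    hA.trans_le hAB, fun c hc => ?_⟩
  · filter_upwards [fourier_atom hφ one_pos q] with ξ h1
    rw [h1, Complex.ofReal_one, one_mul, one_mul, one_mul]
    congr 2
    field_simp
  · obtain ⟨h1, h2, h3⟩ := H c hc
    have h4 := hasSum_fourier h1.hasSum
    simp only [FourierTransform.fourier_smul] at h4
    refine ⟨h4.summable, ?_⟩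
    rw [h4.tsum_eq, Lp.norm_fourier_eq]
    exact ⟨h2, h3⟩

theorem fourierL2_two_pi_mul (g : Lp ℂ 2 (volume : Measure ℝ)) (ξ : ℝ) :
    fourierL2 g (2 * Real.pi * ξ) = (𝓕 g : Lp ℂ 2 (volume : Measure ℝ)) ξ := by
  rw [fourierL2, mul_div_cancel_left₀ _ (by positivity)]

theorem basisHat_two_pi_mul (ξ : ℝ) :
    basisHat φ (2 * Real.pi * ξ) = fun i => basisFourier φ i ξ :=
  funext fun _ => fourierL2_two_pi_mul _ ξ

theorem gram_two_pi_mul (ξ : ℝ) : gram φ (2 * Real.pi * ξ) =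
    ((1 / N : ℝ) : ℂ) • gramSum fun (n : ℤ) i => basisFourier φ i (ξ + n * (1 / N : ℝ)) := by
  ext i j
  simp only [gram, gramSum, Matrix.of_apply, Matrix.smul_apply, smul_eq_mul]
  push_cast
  congr 1
  refine tsum_congr fun n => ?_
  rw [show 2 * Real.pi * ξ + 2 * Real.pi * n / N = 2 * Real.pi * (ξ + n * (1 / N)) by ring,
    basisHat_two_pi_mul]

theorem hasErrorKernel (hN : 1 ≤ N) {p : ℕ} {A B C : ℝ}
    (hR : ModulatedRiesz (1 / N : ℝ) (basisFourier φ) (fun q => 𝓕 (atom φ 1 q)) A B)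
    (hE : ∀ᵐ ω : ℝ, |kernel φ ψ ω| ≤ C ^ 2 * max 1 (|ω| ^ (2 * p))) :
    HasErrorKernel (1 / N : ℝ) (basisFourier φ) (samplingFourier ψ)
      (fun ξ => kernel φ ψ (2 * Real.pi * ξ)) (C ^ 2 * ((2 * Real.pi) ^ 2) ^ p) p := by
  have hN0 : (0 : ℝ) < N := by exact_mod_cast hN
  refine ⟨fun _ => (continuous_fourierDist _).comp (by fun_prop), ?_, ?_⟩
  · filter_upwards [hR.ae_frame] with ξ h1
    have hdet := gramSum_isUnit_det (x := fun (n : ℤ) i => basisFourier φ i (ξ + n * (1 / N : ℝ)))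
      h1.1 (div_pos hR.lower_pos hR.pos) h1.2
    have h2 := hasSum_kernel hR.pos h1.1 hdet (gram_two_pi_mul ξ)
      fun i => samplingFourier ψ i ξ
    convert h2 using 1
    simp only [kernel, kernelMin, kernelRes, dualHat, basisHat_two_pi_mul, Int.cast_zero, zero_mul,
      add_zero]
    rfl
  · have h1 := (quasiMeasurePreserving_mul_left (show 0 < 2 * Real.pi by positivity)).ae hE
    filter_upwards [h1] with ξ h2
    refine (le_abs_self _).trans (h2.trans ?_)
    rw [mul_assoc (C ^ 2)]
    refine mul_le_mul_of_nonneg_left ?_ (sq_nonneg C)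
    have h3 : |2 * Real.pi * ξ| ^ (2 * p) = ((2 * Real.pi) ^ 2) ^ p * (ξ ^ 2) ^ p := by
      rw [pow_mul, sq_abs, mul_pow, mul_pow]
    -- As `2π ≥ 1`, the change of variable costs only the factor `(2π)^(2p)`, also where the maximum
    -- is `1`.
    have h4 : 1 ≤ ((2 * Real.pi) ^ 2) ^ p := by
      refine one_le_pow₀ (one_le_pow₀ ?_)
      linarith [Real.pi_gt_three]
    rw [h3, polyWeight]
    refine max_le ?_ ?_
    · exact h4.trans (le_mul_of_one_le_right (by positivity) (le_max_left _ _))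
    · gcongr
      exact le_max_right _ _

theorem conj_phase (x : ℝ) : conj (phase x) = phase (-x) := by
  rw [phase, phase, ← Complex.exp_conj, map_mul, Complex.conj_ofReal, Complex.conj_I]
  congr 1
  push_cast; ring

theorem pairingIntegrand_sampler (f : Lp ℂ 2 (volume : Measure ℝ)) {T : ℝ} (hT : 0 < T)
    (q : Fin N × ℤ) (ξ : ℝ) : pairingIntegrand f (sampler ψ T q) (2 * Real.pi * ξ) =
      phase (-(T * (N * q.2) * ξ)) * ((𝓕 f : Lp ℂ 2 (volume : Measure ℝ)) ξ *
        conj (samplingFourier ψ q.1 (T * ξ))) := by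
  rw [pairingIntegrand, fourierL2_two_pi_mul, sampler, fourierDist_rescaleDist hT, map_mul,
    conj_phase, samplingFourier]
  ring

/-- The integrand of the pairing is a dilation of that of `samplingCoeff`. -/
theorem samplingIntegrand_dilation (hN : 1 ≤ N) (f : Lp ℂ 2 (volume : Measure ℝ)) {T : ℝ}
    (hT : 0 < T) (q : Fin N × ℤ) :
    (fun ξ => phase (-(q.2 * ξ / (1 / N : ℝ))) * (dilation (inv_pos.2 hT) (𝓕 f) ξ *
      conj (samplingFourier ψ q.1 ξ))) =ᵐ[volume] fun ξ =>
      (T : ℂ)⁻¹ * pairingIntegrand f (sampler ψ T q) (2 * Real.pi * (T⁻¹ * ξ)) := by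
  have hN0 : (N : ℝ) ≠ 0 := by exact_mod_cast (by omega : N ≠ 0)
  filter_upwards [dilation_ae (inv_pos.2 hT) (𝓕 f)] with ξ h1
  rw [h1, pairingIntegrand_sampler f hT, mul_inv_cancel_left₀ hT.ne', Complex.ofReal_inv,
    show T * (N * q.2) * (T⁻¹ * ξ) = q.2 * ξ / (1 / N : ℝ) by field_simp]
  ring

/-- The substitution `ω = 2πξ` cancels the factor `1 / (2π)`; the dilation of `f̂` then absorbs the
scale of the sampler. -/
theorem pairing_sampler (hN : 1 ≤ N) (f : Lp ℂ 2 (volume : Measure ℝ)) {T : ℝ} (hT : 0 < T)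
    (q : Fin N × ℤ) : pairing f (sampler ψ T q) =
      samplingCoeff (1 / N : ℝ) (samplingFourier ψ) (dilation (inv_pos.2 hT) (𝓕 f)) q := by
  rw [samplingCoeff, integral_congr_ae (samplingIntegrand_dilation hN f hT q), integral_const_mul,
    integral_comp_mul_left_pos (inv_pos.2 hT)
      fun ξ => pairingIntegrand f (sampler ψ T q) (2 * Real.pi * ξ),
    integral_comp_mul_left_pos (show 0 < 2 * Real.pi by positivity)
      (pairingIntegrand f (sampler ψ T q)), pairing, Complex.real_smul, Complex.real_smul]
  have : (T : ℂ) ≠ 0 := by exact_mod_cast hT.ne'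
  push_cast
  field_simp

theorem integrable_pairingIntegrand (hN : 1 ≤ N) (f : Lp ℂ 2 (volume : Measure ℝ)) {T : ℝ}
    (hT : 0 < T) (q : Fin N × ℤ)
    (h : Integrable fun ξ => dilation (inv_pos.2 hT) (𝓕 f) ξ *
      conj (samplingFourier ψ q.1 ξ)) : Integrable (pairingIntegrand f (sampler ψ T q)) := by
  have h1 : Integrable fun ξ => phase (-(q.2 * ξ / (1 / N : ℝ))) *
      (dilation (inv_pos.2 hT) (𝓕 f) ξ * conj (samplingFourier ψ q.1 ξ)) :=
    h.bdd_mul (c := 1) (continuous_phase.comp (by fun_prop)).aestronglyMeasurable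
      (Eventually.of_forall fun ξ => (norm_phase _).le)
  have hT0 : (T : ℂ)⁻¹ ≠ 0 := inv_ne_zero (by exact_mod_cast hT.ne')
  rw [integrable_congr (samplingIntegrand_dilation hN f hT q),
    integrable_const_mul_iff (isUnit_iff_ne_zero.2 hT0),
    integrable_comp_mul_left_iff
      (fun ξ => pairingIntegrand f (sampler ψ T q) (2 * Real.pi * ξ)) (inv_ne_zero hT.ne'),
    integrable_comp_mul_left_iff _ (by positivity)] at h1
  exact h1

end Scheme

end GenSampling

/-! ### Reduction of every scale to scale one -/

theorem proposition4 (N : ℕ) (hN : 1 ≤ N) (L p : ℕ) (hpL : p ≤ L)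
    (φ : Fin N → ℝ → ℂ) (hφ : ∀ i, MemLp (φ i) 2 volume)
    (hRiesz : IsRiesz φ)
    (ψ : Fin N → 𝓢'(ℝ, ℂ)) (hψ : ∀ i, IsRapidlyDecaying (ψ i))
    (hbi : IsQuasiBiorthonormal φ ψ L)
    (C : ℝ) (hC : 0 < C)
    (hE : ∀ᵐ ω : ℝ, |kernel φ ψ ω| ≤ C ^ 2 * max 1 (|ω| ^ (2 * p)))
    (f : Lp ℂ 2 (volume : Measure ℝ))
    (hf : TemperedDistribution.MemSobolev ((L : ℝ) + 1) 2 (f : 𝓢'(ℝ, ℂ))) :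
    (∀ T : ℝ, 0 < T →
      (∀ q : Fin N × ℤ, Integrable (pairingIntegrand f (sampler ψ T q))) ∧
      Summable (approxTerm φ ψ T f) ∧
      Integrable (fun ω : ℝ => ‖fourierL2 f ω‖ ^ 2 * kernel φ ψ (T * ω))) ∧
    (fun T : ℝ => ‖f - approx φ ψ T f‖ -
        Real.sqrt (1 / (2 * Real.pi) * ∫ ω : ℝ, ‖fourierL2 f ω‖ ^ 2 * kernel φ ψ (T * ω)))
      =O[𝓝[>] 0] (fun T : ℝ => T ^ (L + 1)) := by
  obtain ⟨A, B, hR⟩ := hRiesz.modulatedRiesz hN hφ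
  have hK := hasErrorKernel (ψ := ψ) hN hR hE
  obtain ⟨M, hM⟩ := hK.error_estimate hR (by positivity) hpL
  have hF := integrable_of_memSobolev hf
  set F : Lp ℂ 2 (volume : Measure ℝ) := 𝓕 f with hFdef
  have hpi : 0 < 2 * Real.pi := by positivity
  have hwint : ∀ T : ℝ, ∀ hT : 0 < T,
      Integrable fun ξ => (ξ ^ 2) ^ (L + 1) * ‖dilation (inv_pos.2 hT) F ξ‖ ^ 2 := by
    intro T hT
    have h1 := (weighted_integrable_dilation_inv hT F fun ξ => (ξ ^ 2) ^ (L + 1)).2 (by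
      refine (hF.const_mul ((T ^ 2) ^ (L + 1))).congr (Eventually.of_forall fun ξ => ?_)
      simp only [mul_pow]; ring)
    simpa only [mul_comm] using h1
  have hsum : ∀ T : ℝ, ∀ hT : 0 < T, HasSum (fun q => 𝓕 (approxTerm φ ψ T f q))
      (dilation hT (∑' q, samplingCoeff (1 / N : ℝ) (samplingFourier ψ)
        (dilation (inv_pos.2 hT) F) q • 𝓕 (atom φ 1 q))) := by
    intro T hT
    have h1 := (hM _ (hwint T hT)).1.hasSum.mapL (dilationCLM hT)
    have h2 : (fun q => 𝓕 (approxTerm φ ψ T f q)) = fun q => dilationCLM hT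
        (samplingCoeff (1 / N : ℝ) (samplingFourier ψ) (dilation (inv_pos.2 hT) F) q •
          𝓕 (atom φ 1 q)) := by
      funext q
      rw [approxTerm, FourierTransform.fourier_smul, fourier_atom_eq_dilation hφ hT,
        pairing_sampler hN f hT, ← map_smul]
      rfl
    rw [h2]
    exact h1
  refine ⟨fun T hT => ⟨fun q => ?_, summable_of_fourier (hsum T hT).summable, ?_⟩, ?_⟩
  · exact integrable_pairingIntegrand hN f hT q
      (hK.integrable_mul_conj hR hpL (hwint T hT) q.1)
  · have h1 := (weighted_integrable_dilation_inv hT F _).1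
      (hK.integrable_kernel hR hpL (hwint T hT))
    rw [← integrable_comp_mul_left_iff _ hpi.ne']
    refine h1.congr (Eventually.of_forall fun ξ => ?_)
    simp only [fourierL2_two_pi_mul, ← hFdef]
    congr 2; ring
  · refine IsBigO.of_bound (M * Real.sqrt (∫ ξ, (ξ ^ 2) ^ (L + 1) * ‖F ξ‖ ^ 2)) ?_
    filter_upwards [self_mem_nhdsWithin] with T hT
    replace hT : 0 < T := hT
    have h1 := (hM _ (hwint T hT)).2
    set S := ∑' q, samplingCoeff (1 / N : ℝ) (samplingFourier ψ)
        (dilation (inv_pos.2 hT) F) q • 𝓕 (atom φ 1 q) with hS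
    -- By Plancherel; the transform of the error is the dilation of the error at scale one, and the
    -- dilation multiplies norms by `√T`.
    have e1 : ‖f - approx φ ψ T f‖ = Real.sqrt T * ‖dilation (inv_pos.2 hT) F - S‖ := by
      have h2 := hasSum_fourier (summable_of_fourier (hsum T hT).summable).hasSum
      have h3 : 𝓕 (approx φ ψ T f) = dilation hT S := h2.unique (hsum T hT)
      rw [← norm_dilation hT, map_sub, dilation_dilation_inv, ← h3, hFdef, ← Lp.norm_fourier_eq]
      congr 1
      exact map_sub (Lp.fourierTransformₗᵢ ℝ ℂ) _ _
    have e2 : 1 / (2 * Real.pi) * ∫ ω : ℝ, ‖fourierL2 f ω‖ ^ 2 * kernel φ ψ (T * ω) =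
        T * ∫ ξ, ‖dilation (inv_pos.2 hT) F ξ‖ ^ 2 * kernel φ ψ (2 * Real.pi * ξ) := by
      rw [weighted_integral_dilation_inv hT F fun ξ => kernel φ ψ (2 * Real.pi * ξ),
        mul_inv_cancel_left₀ hT.ne', one_div, ← smul_eq_mul, ← integral_comp_mul_left_pos hpi]
      refine integral_congr_ae (Eventually.of_forall fun ξ => ?_)
      simp only [fourierL2_two_pi_mul, ← hFdef]
      congr 2; ring
    -- After the square root this is `T^(-1/2) T^(L+1)` times the Sobolev term of `F`; the factor
    -- `√T` of the dilation cancels the first power.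
    have e3 : ∫ ξ, (ξ ^ 2) ^ (L + 1) * ‖dilation (inv_pos.2 hT) F ξ‖ ^ 2 =
        T⁻¹ * ((T ^ (L + 1)) ^ 2 * ∫ ξ, (ξ ^ 2) ^ (L + 1) * ‖F ξ‖ ^ 2) := by
      have h2 := weighted_integral_dilation_inv hT F fun ξ => (ξ ^ 2) ^ (L + 1)
      rw [← integral_const_mul]
      convert h2 using 2
      · funext ξ; ring
      · congr 1; funext ξ; ring
    rw [e1, e2, Real.sqrt_mul hT.le, ← mul_sub, norm_mul, Real.norm_of_nonneg (Real.sqrt_nonneg T),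
      Real.norm_eq_abs, Real.norm_of_nonneg (by positivity : 0 ≤ T ^ (L + 1))]
    refine (mul_le_mul_of_nonneg_left h1 (Real.sqrt_nonneg T)).trans (le_of_eq ?_)
    rw [e3, Real.sqrt_mul (by positivity), Real.sqrt_mul (by positivity),
      Real.sqrt_sq (by positivity), Real.sqrt_inv]
    have : Real.sqrt T ≠ 0 := (Real.sqrt_pos.2 hT).ne'
    field_simp

end
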